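/- Let $n\ge 1$. For $t>0$ and $x,y\in\mathbb R^n$ let $$P_t(x,y)=\frac1{2\pi^{(n+1)/2}}\int_0^\infty \frac{t}{s^{3/2}}\,e^{-\frac{t^2}{4s}}\,\frac{e^{-\frac{|y-e^{-s}x|^2}{1-e^{-2s}}}}{(1-e^{-2s})^{n/2}}\,ds$$ be the Ornstein–Uhlenbeck Poisson kernel. For $x\ne0$ write $y=y_x+y_x'$ with $y_x$ parallel and $y_x'$ orthogonal to $x$; for $x=0$ put $y_x=y$, $y_x'=0$. Given constants $c_1,\dots,c_5>0$, let $$K_1(t,x,y)=\frac{t}{(t^2+|x-y|^2)^{(n+1)/2}}\,e^{-c_1t(1+|x|)},$$ $$K_2(t,x,y)=\frac{t}{|x|}\Bigl(t^2+\frac{|x-y_x|}{|x|}+|y_x'|^2\Bigr)^{-\frac{n+2}2}\exp\Bigl(-c_2\frac{(t^2+|y_x'|^2)|x|}{|x-y_x|}\Bigr)\chi_{\{|x|>1,\ x\cdot y>0,\ |x|/2\le|y_x|<|x|\}},$$ $$K_3(t,x,y)=\min(1,t)\,e^{-c_3|y|^2},$$ $$K_4(t,x,y)=\frac{t}{|y_x|}\Bigl(\log\frac{|x|}{|y_x|}\Bigr)^{-\frac32}\exp\Bigl(-c_4\frac{t^2}{\log(|x|/|y_x|)}\Bigr)e^{-c_5|y_x'|^2}\,\chi_{\{x\cdot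 y>0,\ 1<|y_x|<|x|/2\}}.$$ Define the following sets of points $(t,x,y)\in(0,\infty)\times\mathbb R^n\times\mathbb R^n$: $$E_1=\bigl\{|x|>1,\ x\cdot y>0,\ t^2|x|<|x|-|y_x|<\tfrac1{4|x|},\ |y_x'|<|x|-|y_x|\bigr\},$$ $$E_2=\Bigl\{|x|>1,\ x\cdot y>0,\ t|x|>1,\ t^2|x|<|x|-|y_x|<\tfrac{|x|}4,\ |y_x'|<\sqrt{\tfrac{|x|-|y_x|}{|x|}}\Bigr\},$$ $$E_3=\{t>1,\ |x|<1,\ |y|<1\},$$ $$E_4=\bigl\{|x|>e^{16},\ x\cdot y>0,\ t=\tfrac12\sqrt{\log|x|},\ |x|^{2/3}\le|y_x|\le|x|^{3/4},\ |y_x'|<1\bigr\}.$$ Theorem 6.1. For every choice of the constants $c_1,\dots,c_5>0$ and each $i\in\{1,2,3,4\}$: (a) $P_t(x,y)\simeq K_i(t,x,y)$ uniformly in $E_i$; that is, there is a constant $C>0$, depending only on $n$ and $c_1,\dots,c_5$, such that $C^{-1}K_i(t,x,y)\le P_t(x,y)\le C\,K_i(t,x,y)$ for all $(t,x,y)\in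 E_i$. (b) The term $K_i$ cannot be suppressed in the estimate $P_t\le C(K_1+K_2+K_3+K_4)$: for every $\varepsilon>0$ there is a point $(t,x,y)\in E_i$ at which $K_j(t,x,y)<\varepsilon P_t(x,y)$ for all $j\ne i$; and there is no constant $C$ such that $P_t(x,y)\le C\sum_{j\ne i}K_j(t,x,y)$ for all $t>0$ and $x,y\in\mathbb R^n$. -/

import Mathlib

namespace OUPoisson

/-- Euclidean space of dimension `n`, with the Euclidean norm and inner product. -/
abbrev Rn (n : ℕ) : Type := EuclideanSpace ℝ (Fin n)

/-- The Mehler kernel `M_r(x,y) = (1-r²)^{-n/2} exp(-|y-rx|²/(1-r²))`, for `0 < r < 1`. -/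
noncomputable def mehler {n : ℕ} (r : ℝ) (x y : Rn n) : ℝ :=
  Real.exp (-(‖y - r • x‖ ^ 2 / (1 - r ^ 2))) / (1 - r ^ 2) ^ ((n : ℝ) / 2)

/-- The Ornstein-Uhlenbeck Poisson kernel, obtained from the Mehler kernel by subordination:
`P_t(x,y) = 1/(2π^{(n+1)/2}) ∫_0^∞ t s^{-3/2} e^{-t²/(4s)} M_{e^{-s}}(x,y) ds`, for `t > 0`. -/
noncomputable def P {n : ℕ} (t : ℝ) (x y : Rn n) : ℝ :=
  1 / (2 * Real.pi ^ (((n : ℝ) + 1) / 2)) *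
    ∫ s in Set.Ioi (0 : ℝ),
      t / s ^ ((3 : ℝ) / 2) * Real.exp (-(t ^ 2 / (4 * s))) * mehler (Real.exp (-s)) x y

open Classical in
/-- The component `y_x` of `y` parallel to `x`, with the convention `y_x = y` if `x = 0`. -/
noncomputable def par {n : ℕ} (x y : Rn n) : Rn n :=
  if x = 0 then y else (inner ℝ x y / ‖x‖ ^ 2) • x

/-- The component `y_x'` of `y` orthogonal to `x`, so that `y = y_x + y_x'`. -/
noncomputable def perp {n : ℕ} (x y : Rn n) : Rn n := y - par x y

/-! The four kernels. Each factor `exp*(-X)` is `exp(-c X)`, and the constant `c` is an explicit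
argument (`K4` has two such factors, hence two constants). -/

noncomputable def K1 {n : ℕ} (c t : ℝ) (x y : Rn n) : ℝ :=
  t / (t ^ 2 + ‖x - y‖ ^ 2) ^ (((n : ℝ) + 1) / 2) * Real.exp (-c * (t * (1 + ‖x‖)))

open Classical in
noncomputable def K2 {n : ℕ} (c t : ℝ) (x y : Rn n) : ℝ :=
  if 1 < ‖x‖ ∧ 0 < inner ℝ x y ∧ ‖x‖ / 2 ≤ ‖par x y‖ ∧ ‖par x y‖ < ‖x‖ then
    t / ‖x‖ * (t ^ 2 + ‖x - par x y‖ / ‖x‖ + ‖perp x y‖ ^ 2) ^ (-(((n : ℝ) + 2) / 2)) *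
      Real.exp (-c * ((t ^ 2 + ‖perp x y‖ ^ 2) * ‖x‖ / ‖x - par x y‖))
  else 0

noncomputable def K3 {n : ℕ} (c t : ℝ) (_x y : Rn n) : ℝ :=
  min 1 t * Real.exp (-c * ‖y‖ ^ 2)

open Classical in
noncomputable def K4 {n : ℕ} (c c' t : ℝ) (x y : Rn n) : ℝ :=
  if 0 < inner ℝ x y ∧ 1 < ‖par x y‖ ∧ ‖par x y‖ < ‖x‖ / 2 then
    t / ‖par x y‖ * Real.log (‖x‖ / ‖par x y‖) ^ (-((3 : ℝ) / 2)) *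
      Real.exp (-c * (t ^ 2 / Real.log (‖x‖ / ‖par x y‖))) *
      Real.exp (-c' * ‖perp x y‖ ^ 2)
  else 0

/-- The four kernels as a family (`K c 0`, …, `K c 3` are `K_1`, …, `K_4`); `c` collects the
constants in the five factors `exp*`. -/
noncomputable def K {n : ℕ} (c : Fin 5 → ℝ) : Fin 4 → ℝ → Rn n → Rn n → ℝ :=
  ![K1 (c 0), K2 (c 1), K3 (c 2), K4 (c 3) (c 4)]

def E1 (n : ℕ) : Set (ℝ × Rn n × Rn n) :=
  {p | match p with
    | (t, x, y) => 0 < t ∧ 1 < ‖x‖ ∧ 0 < inner ℝ x y ∧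
        t ^ 2 * ‖x‖ < ‖x‖ - ‖par x y‖ ∧ ‖x‖ - ‖par x y‖ < 1 / (4 * ‖x‖) ∧
        ‖perp x y‖ < ‖x‖ - ‖par x y‖}

def E2 (n : ℕ) : Set (ℝ × Rn n × Rn n) :=
  {p | match p with
    | (t, x, y) => 0 < t ∧ 1 < ‖x‖ ∧ 0 < inner ℝ x y ∧ 1 < t * ‖x‖ ∧
        t ^ 2 * ‖x‖ < ‖x‖ - ‖par x y‖ ∧ ‖x‖ - ‖par x y‖ < ‖x‖ / 4 ∧
        ‖perp x y‖ < Real.sqrt ((‖x‖ - ‖par x y‖) / ‖x‖)}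

def E3 (n : ℕ) : Set (ℝ × Rn n × Rn n) :=
  {p | match p with
    | (t, x, y) => 1 < t ∧ ‖x‖ < 1 ∧ ‖y‖ < 1}

def E4 (n : ℕ) : Set (ℝ × Rn n × Rn n) :=
  {p | match p with
    | (t, x, y) => Real.exp 16 < ‖x‖ ∧ 0 < inner ℝ x y ∧ t = Real.sqrt (Real.log ‖x‖) / 2 ∧
        ‖x‖ ^ ((2 : ℝ) / 3) ≤ ‖par x y‖ ∧ ‖par x y‖ ≤ ‖x‖ ^ ((3 : ℝ) / 4) ∧
        ‖perp x y‖ < 1}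

/-- The four regions as a family (`E n 0`, …, `E n 3` are `E_1`, …, `E_4`). -/
def E (n : ℕ) : Fin 4 → Set (ℝ × Rn n × Rn n) := ![E1 n, E2 n, E3 n, E4 n]

end OUPoisson

namespace OUPoisson

open MeasureTheory Set

/-! ### Elementary estimates -/

/-! When $x\cdot y>0$, write $R=|x|$, $a=|y_x|$, $w=|y_x'|$. Then $|y-e^{-s}x|^2=(a-e^{-s}R)^2+w^2$,
so $P_t$ is a constant times $t$ times a one-dimensional integral over $s$ (`P_eq_Q`), in which
$1-e^{-2s}$ behaves like $\min(1,s)$. On each region one range of $s$ carries the integral.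

On $E_1$ the drift $(1-e^{-s})R$ is harmless and the mass sits at $s\sim A=t^2+|x-y|^2$, as for the
Euclidean Poisson kernel (`integral_near`). On $E_2$ and $E_4$ the integrand peaks at the time
$s_0=\log(R/a)$ when $e^{-s}x$ reaches $y_x$, and Laplace's method gives height times width. On
$E_2$, with $\sigma=(R-a)/R$, one has $s_0\sim\sigma$, height $\sigma^{-(n+3)/2}$ and width
$\sqrt\sigma/R$ (`integral_mid`). On $E_4$, $s_0$ is large, the variance is of order 1, the height
is $s_0^{-3/2}$ and the width $1/a$ (`integral_far`). On $E_3$ the Mehler kernel is of order 1 for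
$s\ge1$, and the subordination density puts the mass at $s\sim t^2$ (`integral_large_t`). Lower
bounds come from one window around the main range; upper bounds from explicit integrable majorants.
On $E_i$ the exponential factors of $K_i$ lie between positive constants, so the values of
$c_1,\dots,c_5$ affect only the constant $C$.

For (b), collinear points $x=Re$, $y=ae$ (or $x=y=0$ for $K_3$) make $K_i$ exceed each other kernel
by an arbitrary factor (`K1_dominates` to `K4_dominates`). By (a), $K_i$ may be replaced by $P_t$,
and smallness of the three other kernels rules out a bound by their sum. -/

lemma exp_neg_le_rpow {k c : ℝ} (hk : 0 < k) (hc : 0 < c) :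
    ∃ C : ℝ, 0 < C ∧ ∀ u : ℝ, 0 ≤ u → Real.exp (-(c * u)) ≤ C * (1 + u) ^ (-k) := by
  -- The constant comes from raising $z\le e^z$ at $z=c(1+u)/k$ to the power $k$.
  refine ⟨Real.exp c * (k / c) ^ k, by positivity, fun u hu => ?_⟩
  have h1 : (c * (1 + u) / k) ^ k ≤ Real.exp (c * (1 + u)) := by
    have h2 : c * (1 + u) / k ≤ Real.exp (c * (1 + u) / k) := by
      linarith [Real.add_one_le_exp (c * (1 + u) / k)]
    calc (c * (1 + u) / k) ^ k ≤ (Real.exp (c * (1 + u) / k)) ^ k :=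
          Real.rpow_le_rpow (by positivity) h2 hk.le
      _ = Real.exp (c * (1 + u)) := by rw [← Real.exp_mul]; congr 1; field_simp
  have h3 : (c * (1 + u) / k) ^ k = (1 + u) ^ k / (k / c) ^ k := by
    rw [← Real.div_rpow (by positivity) (by positivity)]; congr 1; field_simp
  have h4 : (1 + u) ^ k ≤ (k / c) ^ k * Real.exp (c * (1 + u)) := by
    rw [h3, div_le_iff₀ (by positivity)] at h1; linarith
  have h5 : Real.exp (-(c * u)) = Real.exp c * (Real.exp (c * (1 + u)))⁻¹ := by
    rw [← Real.exp_neg, ← Real.exp_add]; congr 1; ring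
  rw [h5, mul_assoc, Real.rpow_neg (by positivity)]
  refine mul_le_mul_of_nonneg_left ?_ (Real.exp_pos c).le
  rw [← div_eq_mul_inv, le_div_iff₀ (by positivity), inv_mul_le_iff₀ (by positivity)]
  linarith

lemma exp_neg_le_rpow' {k c : ℝ} (hk : 0 < k) (hc : 0 < c) :
    ∃ C : ℝ, 0 < C ∧ ∀ u : ℝ, 0 < u → Real.exp (-(c * u)) ≤ C * u ^ (-k) := by
  obtain ⟨C, hC, h⟩ := exp_neg_le_rpow hk hc
  refine ⟨C, hC, fun u hu => (h u hu.le).trans ?_⟩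
  gcongr C * ?_
  exact Real.rpow_le_rpow_of_nonpos hu (by linarith) (by linarith)

/-- The exponential removes the singularity at $s=0$, leaving a shifted power whose integral over
$s$ is explicit. -/
lemma rpow_neg_mul_exp_le {k c : ℝ} (hk : 0 < k) (hc : 0 < c) :
    ∃ C : ℝ, 0 < C ∧ ∀ s A : ℝ, 0 < s → 0 ≤ A →
      s ^ (-k) * Real.exp (-(c * (A / s))) ≤ C * (s + A) ^ (-k) := by
  obtain ⟨C, hC, h⟩ := exp_neg_le_rpow hk hc
  refine ⟨C, hC, fun s A hs hA => ?_⟩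
  calc s ^ (-k) * Real.exp (-(c * (A / s))) ≤ s ^ (-k) * (C * (1 + A / s) ^ (-k)) := by
        gcongr; exact h _ (by positivity)
    _ = C * (s ^ (-k) * (1 + A / s) ^ (-k)) := by ring
    _ = C * (s + A) ^ (-k) := by
        rw [← Real.mul_rpow hs.le (by positivity)]; congr 2; field_simp

/-- The variance factor `1 - e^{-2s}` of the Mehler kernel. -/
noncomputable def var (s : ℝ) : ℝ := 1 - Real.exp (-s) ^ 2

lemma exp_neg_le_inv {s : ℝ} (hs : 0 < s) : Real.exp (-s) ≤ 1 / (1 + s) := by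
  rw [Real.exp_neg, ← one_div]
  exact one_div_le_one_div_of_le (by linarith) (by linarith [Real.add_one_le_exp s])

lemma var_eq (s : ℝ) : var s = 1 - Real.exp (-(2 * s)) := by
  rw [var, ← Real.exp_nat_mul]; congr 2; push_cast; ring

lemma var_pos {s : ℝ} (hs : 0 < s) : 0 < var s := by
  rw [var_eq, sub_pos, Real.exp_lt_one_iff]; linarith

lemma var_le_one (s : ℝ) : var s ≤ 1 := by
  have := Real.exp_pos (-(2 * s)); rw [var_eq]; linarith

lemma var_le (s : ℝ) : var s ≤ 2 * s := by
  have := Real.add_one_le_exp (-(2 * s)); rw [var_eq]; linarith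

lemma le_var_of_le_one {s : ℝ} (hs : 0 < s) (hs1 : s ≤ 1) : 2 / 3 * s ≤ var s := by
  have := exp_neg_le_inv (s := 2 * s) (by linarith)
  have h : 1 / (1 + 2 * s) ≤ 1 - 2 / 3 * s := by
    rw [div_le_iff₀ (by linarith)]; nlinarith
  rw [var_eq]; linarith

lemma le_var_of_one_le {s : ℝ} (hs : 1 ≤ s) : 2 / 3 ≤ var s := by
  have := exp_neg_le_inv (s := 2 * s) (by linarith)
  have h : 1 / (1 + 2 * s) ≤ 1 / 3 := one_div_le_one_div_of_le (by norm_num) (by linarith)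
  rw [var_eq]; linarith

lemma var_rpow_le_of_le_one {p s : ℝ} (hp : 0 ≤ p) (hs : 0 < s) (hs1 : s ≤ 1) :
    var s ^ (-p) ≤ (2 / 3 : ℝ) ^ (-p) * s ^ (-p) := by
  rw [← Real.mul_rpow (by norm_num) hs.le]
  exact Real.rpow_le_rpow_of_nonpos (by linarith) (le_var_of_le_one hs hs1) (by linarith)

lemma var_rpow_le_of_one_le {p s : ℝ} (hp : 0 ≤ p) (hs : 1 ≤ s) :
    var s ^ (-p) ≤ (2 / 3 : ℝ) ^ (-p) :=
  Real.rpow_le_rpow_of_nonpos (by norm_num) (le_var_of_one_le hs) (by linarith)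

lemma le_var_rpow {p s : ℝ} (hp : 0 ≤ p) (hs : 0 < s) : (2 * s) ^ (-p) ≤ var s ^ (-p) :=
  Real.rpow_le_rpow_of_nonpos (var_pos hs) (var_le s) (by linarith)

lemma one_le_var_rpow {p s : ℝ} (hp : 0 ≤ p) (hs : 0 < s) : 1 ≤ var s ^ (-p) :=
  Real.one_le_rpow_of_pos_of_le_one_of_nonpos (var_pos hs) (var_le_one s) (by linarith)

lemma rpow_neg_le_mul_rpow_neg {k b x y : ℝ} (hk : 0 ≤ k) (hb : 0 < b) (hx : 0 < x)
    (hy : 0 < y) (h : y ≤ b * x) : x ^ (-k) ≤ b ^ k * y ^ (-k) := by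
  have : x ^ (-k) = b ^ k * (b * x) ^ (-k) := by
    rw [Real.mul_rpow hb.le hx.le, ← mul_assoc, ← Real.rpow_add hb]; simp
  rw [this]
  gcongr b ^ k * ?_
  exact Real.rpow_le_rpow_of_nonpos hy h (by linarith)

/-! ### Model integrals: shifted powers and Gaussians. -/

lemma integrableOn_add_rpow {A q : ℝ} (hA : 0 < A) (hq : 1 < q) :
    IntegrableOn (fun s : ℝ => (s + A) ^ (-q)) (Ioi 0) :=
  integrableOn_add_rpow_Ioi_of_lt (by linarith) (by linarith)

lemma integral_add_rpow {A q : ℝ} (hA : 0 < A) (hq : 1 < q) :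
    ∫ s in Ioi (0 : ℝ), (s + A) ^ (-q) = A ^ (1 - q) / (q - 1) := by
  have hd : ∀ x ∈ Ici (0 : ℝ),
      HasDerivAt (fun s : ℝ => (s + A) ^ (-q + 1) / (-q + 1)) ((x + A) ^ (-q)) x := by
    intro x hx
    have h0 : x + A ≠ 0 := by linarith [mem_Ici.mp hx]
    have h1 : -q + 1 ≠ 0 := by linarith
    have h2 := (((hasDerivAt_id x).add_const A).rpow_const (p := -q + 1)
      (Or.inl h0)).div_const (-q + 1)
    refine h2.congr_deriv ?_
    rw [add_sub_cancel_right, one_mul, mul_div_cancel_left₀ _ h1]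
    rfl
  have ht : Filter.Tendsto (fun s : ℝ => (s + A) ^ (-q + 1) / (-q + 1)) Filter.atTop
      (nhds (0 / (-q + 1))) := by
    rw [show -q + 1 = -(q - 1) by ring]
    exact ((tendsto_rpow_neg_atTop (by linarith)).comp
      (Filter.tendsto_atTop_add_const_right _ A Filter.tendsto_id)).div_const _
  rw [integral_Ioi_of_hasDerivAt_of_tendsto' hd (integrableOn_add_rpow hA hq) ht]
  rw [show -q + 1 = -(q - 1) by ring, show 1 - q = -(q - 1) by ring, zero_add, zero_div,
    div_neg, sub_neg_eq_add, zero_add]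

lemma integrable_gauss {b : ℝ} (hb : 0 < b) (s₀ : ℝ) :
    Integrable (fun s : ℝ => Real.exp (-(b * (s - s₀) ^ 2))) := by
  have := (integrable_exp_neg_mul_sq hb).comp_sub_right s₀
  simpa [neg_mul] using this

lemma integral_gauss_le {b : ℝ} (hb : 0 < b) (s₀ : ℝ) :
    ∫ s in Ioi (0 : ℝ), Real.exp (-(b * (s - s₀) ^ 2)) ≤ Real.sqrt (Real.pi / b) := by
  have h1 : ∫ s : ℝ, Real.exp (-(b * (s - s₀) ^ 2)) = Real.sqrt (Real.pi / b) := by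
    rw [← integral_gaussian b, ← integral_sub_right_eq_self (fun s => Real.exp (-b * s ^ 2)) s₀]
    simp [neg_mul]
  rw [← h1]
  exact setIntegral_le_integral (integrable_gauss hb s₀)
    (Filter.Eventually.of_forall fun _ => (Real.exp_pos _).le)

/-! ### The subordination integrand -/

/-- The subordination integrand, without the factor `t`; `q s` stands for `|y - e^{-s}x|²` and
`p` for `n/2`. -/
noncomputable def H (p t : ℝ) (q : ℝ → ℝ) (s : ℝ) : ℝ :=
  s ^ (-(3 / 2 : ℝ)) * Real.exp (-(t ^ 2 / (4 * s))) * Real.exp (-(q s / var s)) * var s ^ (-p)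

lemma H_nonneg {p t : ℝ} {q : ℝ → ℝ} {s : ℝ} (hs : 0 < s) : 0 ≤ H p t q s := by
  have := var_pos hs
  unfold H; positivity

/-- For small $s$ the variance is comparable to $s$, so it adds $s^{-p}$ to the subordination power.
`E` is whatever part of the total exponent one chooses to keep. -/
lemma H_le_of_le_one {p t : ℝ} {q : ℝ → ℝ} {s E : ℝ} (hp : 0 ≤ p) (hs : 0 < s) (hs1 : s ≤ 1)
    (hE : E ≤ t ^ 2 / (4 * s) + q s / var s) :
    H p t q s ≤ (2 / 3 : ℝ) ^ (-p) * (s ^ (-(p + 3 / 2)) * Real.exp (-E)) := by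
  have h1 := var_rpow_le_of_le_one hp hs hs1
  have h2 : Real.exp (-(t ^ 2 / (4 * s))) * Real.exp (-(q s / var s)) ≤ Real.exp (-E) := by
    rw [← Real.exp_add]; exact Real.exp_le_exp.2 (by linarith)
  calc H p t q s = s ^ (-(3 / 2 : ℝ)) *
        (Real.exp (-(t ^ 2 / (4 * s))) * Real.exp (-(q s / var s))) * var s ^ (-p) := by
        unfold H; ring
    _ ≤ s ^ (-(3 / 2 : ℝ)) * Real.exp (-E) * ((2 / 3 : ℝ) ^ (-p) * s ^ (-p)) := by
        have := var_pos hs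
        gcongr
    _ = _ := by
        rw [show -(p + 3 / 2) = -(3 / 2 : ℝ) + -p by ring, Real.rpow_add hs]; ring

lemma H_le_of_one_le {p t : ℝ} {q : ℝ → ℝ} {s E : ℝ} (hp : 0 ≤ p) (hs : 1 ≤ s)
    (hE : E ≤ t ^ 2 / (4 * s) + q s / var s) :
    H p t q s ≤ (2 / 3 : ℝ) ^ (-p) * (s ^ (-(3 / 2 : ℝ)) * Real.exp (-E)) := by
  have h1 := var_rpow_le_of_one_le hp hs
  have h2 : Real.exp (-(t ^ 2 / (4 * s))) * Real.exp (-(q s / var s)) ≤ Real.exp (-E) := by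
    rw [← Real.exp_add]; exact Real.exp_le_exp.2 (by linarith)
  have hs0 : 0 < s := by linarith
  calc H p t q s = s ^ (-(3 / 2 : ℝ)) *
        (Real.exp (-(t ^ 2 / (4 * s))) * Real.exp (-(q s / var s))) * var s ^ (-p) := by
        unfold H; ring
    _ ≤ s ^ (-(3 / 2 : ℝ)) * Real.exp (-E) * ((2 / 3 : ℝ) ^ (-p)) := by
        have := var_pos hs0
        gcongr
    _ = _ := by ring

lemma rpow_le_add_one_rpow {k s : ℝ} (hk : 0 ≤ k) (hs : 1 ≤ s) :
    s ^ (-k) ≤ 2 ^ k * (s + 1) ^ (-k) :=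
  rpow_neg_le_mul_rpow_neg hk two_pos (by linarith) (by linarith) (by linarith)

lemma le_H {p t : ℝ} {q : ℝ → ℝ} {s u v E : ℝ} (hs : 0 < s) (hsu : s ≤ u)
    (hv : v ≤ var s ^ (-p)) (hv0 : 0 ≤ v)
    (hE : t ^ 2 / (4 * s) + q s / var s ≤ E) :
    u ^ (-(3 / 2 : ℝ)) * Real.exp (-E) * v ≤ H p t q s := by
  have h1 : u ^ (-(3 / 2 : ℝ)) ≤ s ^ (-(3 / 2 : ℝ)) :=
    Real.rpow_le_rpow_of_nonpos hs hsu (by norm_num)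
  have h2 : Real.exp (-E) ≤ Real.exp (-(t ^ 2 / (4 * s))) * Real.exp (-(q s / var s)) := by
    rw [← Real.exp_add]; exact Real.exp_le_exp.2 (by linarith)
  unfold H
  rw [mul_assoc (s ^ _)]
  gcongr

/-- Only $e^{-t^2/(4s)}$ is kept and the Mehler exponential is dropped. This suffices for
integrability, and is sharp enough when $t\ge1$. -/
lemma H_le_general {p : ℝ} (hp : 0 ≤ p) : ∃ C : ℝ, 0 < C ∧ ∀ (t : ℝ) (q : ℝ → ℝ), 0 < t →
    (∀ s, 0 < s → 0 ≤ q s) → ∀ s, 0 < s →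
      H p t q s ≤ C * ((s + t ^ 2) ^ (-(p + 3 / 2)) + (s + t ^ 2) ^ (-(3 / 2 : ℝ))) := by
  obtain ⟨C₁, hC₁, h₁⟩ := rpow_neg_mul_exp_le (k := p + 3 / 2) (c := 1 / 4) (by linarith)
    (by norm_num)
  obtain ⟨C₂, hC₂, h₂⟩ := rpow_neg_mul_exp_le (k := 3 / 2) (c := 1 / 4) (by norm_num)
    (by norm_num)
  refine ⟨(2 / 3 : ℝ) ^ (-p) * (C₁ + C₂), by positivity, fun t q ht hq s hs => ?_⟩
  have hE : 1 / 4 * (t ^ 2 / s) ≤ t ^ 2 / (4 * s) + q s / var s := by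
    have h3 : 0 ≤ q s / var s := div_nonneg (hq s hs) (var_pos hs).le
    have h4 : 1 / 4 * (t ^ 2 / s) = t ^ 2 / (4 * s) := by field_simp
    linarith
  have e1 : 0 < (s + t ^ 2) ^ (-(p + 3 / 2)) := by positivity
  have e2 : 0 < (s + t ^ 2) ^ (-(3 / 2 : ℝ)) := by positivity
  rw [mul_assoc]
  rcases le_total s 1 with hs1 | hs1
  · refine (H_le_of_le_one hp hs hs1 hE).trans ?_
    refine mul_le_mul_of_nonneg_left ?_ (by positivity)
    refine (h₁ s (t ^ 2) hs (by positivity)).trans ?_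
    nlinarith [mul_pos hC₁ e2, mul_pos hC₂ e1, mul_pos hC₂ e2]
  · refine (H_le_of_one_le hp hs1 hE).trans ?_
    refine mul_le_mul_of_nonneg_left ?_ (by positivity)
    refine (h₂ s (t ^ 2) hs (by positivity)).trans ?_
    nlinarith [mul_pos hC₁ e2, mul_pos hC₁ e1, mul_pos hC₂ e1]

lemma integrableOn_H {p t : ℝ} {q : ℝ → ℝ} (hp : 0 ≤ p) (ht : 0 < t) (hqm : Measurable q)
    (hq : ∀ s, 0 < s → 0 ≤ q s) : IntegrableOn (H p t q) (Ioi 0) := by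
  obtain ⟨C, -, h⟩ := H_le_general hp
  have hm : Measurable (H p t q) := by
    have : Measurable var := by unfold var; fun_prop
    unfold H; fun_prop
  have hi := ((integrableOn_add_rpow (A := t ^ 2) (q := p + 3 / 2) (by positivity)
    (by linarith)).add (integrableOn_add_rpow (A := t ^ 2) (q := 3 / 2) (by positivity)
    (by norm_num))).const_mul C
  refine Integrable.mono' hi hm.aestronglyMeasurable ?_
  refine (ae_restrict_iff' measurableSet_Ioi).2 (Filter.Eventually.of_forall fun s hs => ?_)
  rw [Real.norm_of_nonneg (H_nonneg hs)]
  exact h t q ht hq s hs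

lemma integral_H_le {p t : ℝ} {q g : ℝ → ℝ} {M : ℝ} (hg : IntegrableOn g (Ioi 0))
    (hle : ∀ s, 0 < s → H p t q s ≤ g s) (hM : ∫ s in Ioi (0 : ℝ), g s ≤ M) :
    ∫ s in Ioi (0 : ℝ), H p t q s ≤ M := by
  refine le_trans (integral_mono_of_nonneg ?_ hg ?_) hM
  · exact (ae_restrict_iff' measurableSet_Ioi).2
      (Filter.Eventually.of_forall fun s hs => H_nonneg hs)
  · exact (ae_restrict_iff' measurableSet_Ioi).2
      (Filter.Eventually.of_forall fun s hs => hle s hs)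

lemma le_integral_H {p t : ℝ} {q : ℝ → ℝ} {α β m : ℝ} (hi : IntegrableOn (H p t q) (Ioi 0))
    (hα : 0 < α) (hαβ : α ≤ β) (hm : ∀ s, α ≤ s → s ≤ β → m ≤ H p t q s) :
    (β - α) * m ≤ ∫ s in Ioi (0 : ℝ), H p t q s := by
  have hsub : Icc α β ⊆ Ioi 0 := fun s hs => lt_of_lt_of_le hα hs.1
  have h1 : ∫ s in Icc α β, H p t q s ≤ ∫ s in Ioi (0 : ℝ), H p t q s :=
    setIntegral_mono_set hi ((ae_restrict_iff' measurableSet_Ioi).2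
      (Filter.Eventually.of_forall fun s hs => H_nonneg hs)) hsub.eventuallyLE
  refine le_trans ?_ h1
  have h2 : ∫ _ in Icc α β, m = (β - α) * m := by
    simp [hαβ]
  rw [← h2]
  refine setIntegral_mono_on ?_ (hi.mono_set hsub) measurableSet_Icc fun s hs => hm s hs.1 hs.2
  exact integrableOn_const (by simp)

/-! ### Two-sided bounds for the subordination integral -/

/-- `|y - e^{-s}x|²` in terms of `a = |y_x|`, `R = |x|`, `w = |y_x'|`. -/
noncomputable def Q (a R w s : ℝ) : ℝ := (a - Real.exp (-s) * R) ^ 2 + w ^ 2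

lemma Q_nonneg (a R w s : ℝ) : 0 ≤ Q a R w s := by unfold Q; positivity

lemma measurable_Q (a R w : ℝ) : Measurable (Q a R w) := by unfold Q; fun_prop

lemma integrableOn_HQ {p t : ℝ} (hp : 0 ≤ p) (ht : 0 < t) (a R w : ℝ) :
    IntegrableOn (H p t (Q a R w)) (Ioi 0) :=
  integrableOn_H hp ht (measurable_Q a R w) fun s _ => Q_nonneg a R w s

lemma div_two_mul_le {q₀ q s : ℝ} (hs : 0 < s) (hq : q₀ ≤ q) (h0 : 0 ≤ q) :
    q₀ / (2 * s) ≤ q / var s :=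
  (div_le_div_of_nonneg_right hq (by linarith)).trans
    (div_le_div_of_nonneg_left h0 (var_pos hs) (var_le s))

lemma le_div_var {q₀ q s : ℝ} (hs : 0 < s) (hq : q₀ ≤ q) (h0 : 0 ≤ q) : q₀ ≤ q / var s := by
  rw [le_div_iff₀ (var_pos hs)]
  nlinarith [var_le_one s, var_pos hs]

lemma sq_rpow_neg_half {R : ℝ} (hR : 0 < R) : (R ^ 2) ^ (-(1 / 2 : ℝ)) = R⁻¹ := by
  rw [← Real.rpow_natCast, ← Real.rpow_mul hR.le]
  norm_num [Real.rpow_neg_one]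

lemma sq_mul_sq_le (R : ℝ) {m x : ℝ} (hm : 0 ≤ m) (h : m ≤ x) :
    R ^ 2 * m ^ 2 ≤ R ^ 2 * x ^ 2 :=
  mul_le_mul_of_nonneg_left (pow_le_pow_left₀ hm h 2) (sq_nonneg R)

/-- If $2Rs\le d$, the drift uses up at most half of the gap $d$, so the full Euclidean exponent
survives up to a factor. If $2Rs\ge d$, then $(t^2+d^2+w^2)/s\le3$ and the left side is nonpositive,
which explains the loss $3/8$. -/
lemma near_exponent {t d w R s : ℝ} (hR : 1 < R) (hd : 0 < d)
    (h1 : t ^ 2 * R < d) (h2 : d * (4 * R) < 1) (hw0 : 0 ≤ w) (hw : w < d) (hs : 0 < s) :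
    (1 / 8) * ((t ^ 2 + (d ^ 2 + w ^ 2)) / s) - 3 / 8
      ≤ t ^ 2 / (4 * s) + Q (R - d) R w s / var s := by
  have hQ0 : 0 ≤ Q (R - d) R w s / var s := div_nonneg (Q_nonneg _ _ _ _) (var_pos hs).le
  have e0 : t ^ 2 / (4 * s) = 2 / 8 * (t ^ 2 / s) := by field_simp; ring
  have e1 : 0 ≤ t ^ 2 / s := by positivity
  have e2 : 0 ≤ d ^ 2 / s := by positivity
  have e3 : 0 ≤ w ^ 2 / s := by positivity
  have e4 : (t ^ 2 + (d ^ 2 + w ^ 2)) / s = t ^ 2 / s + (d ^ 2 / s + w ^ 2 / s) := by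
    rw [add_div, add_div]
  rcases le_total (2 * R * s) d with h | h
  · have hexp := Real.add_one_le_exp (-s)
    have hexp1 : Real.exp (-s) ≤ 1 := by rw [Real.exp_le_one_iff]; linarith
    have hq : d ^ 2 / 4 + w ^ 2 ≤ Q (R - d) R w s := by
      have : d / 2 ≤ -(R - d - Real.exp (-s) * R) := by nlinarith
      unfold Q; nlinarith
    have := div_two_mul_le hs hq (Q_nonneg _ _ _ _)
    have e5 : (d ^ 2 / 4 + w ^ 2) / (2 * s) = 1 / 8 * (d ^ 2 / s) + 1 / 2 * (w ^ 2 / s) := by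
      field_simp; ring
    rw [e4]; linarith
  · have : (t ^ 2 + (d ^ 2 + w ^ 2)) / s ≤ 3 := by
      rw [div_le_iff₀ hs]
      have h3 : (t ^ 2 + (d ^ 2 + w ^ 2)) * R ≤ 3 * s * R := by nlinarith
      exact le_of_mul_le_mul_right h3 (by linarith)
    linarith [show 0 ≤ t ^ 2 / (4 * s) by rw [e0]; positivity]

set_option maxHeartbeats 800000 in
-- With $A=t^2+d^2+w^2$ the hypotheses force $AR^2\le3/8$, so at times $s\sim A$ the squared drift
-- $(sR)^2$ is at most of order $s$ and is invisible to the Gaussian.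
lemma integral_near {p : ℝ} (hp : 0 ≤ p) : ∃ c C : ℝ, 0 < c ∧ 0 < C ∧ ∀ t d w R : ℝ, 0 < t →
    1 < R → t ^ 2 * R < d → d * (4 * R) < 1 → 0 ≤ w → w < d →
    c * (t ^ 2 + (d ^ 2 + w ^ 2)) ^ (-(p + 1 / 2)) ≤ ∫ s in Ioi (0 : ℝ), H p t (Q (R - d) R w) s ∧
    ∫ s in Ioi (0 : ℝ), H p t (Q (R - d) R w) s
      ≤ C * (t ^ 2 + (d ^ 2 + w ^ 2)) ^ (-(p + 1 / 2)) := by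
  obtain ⟨C₁, hC₁, h₁⟩ := rpow_neg_mul_exp_le (k := p + 3 / 2) (c := 1 / 8) (by linarith)
    (by norm_num)
  set κ : ℝ := (2 / 3 : ℝ) ^ (-p) with hκ
  have hκ0 : 0 < κ := by positivity
  set D : ℝ := κ * (Real.exp (3 / 8) * C₁ + 2 ^ (3 / 2 : ℝ)) with hD
  have hD0 : 0 < D := by positivity
  refine ⟨2 ^ (-(3 / 2 : ℝ)) * Real.exp (-6) * 4 ^ (-p), D * (1 / (p + 1 / 2) + 2),
    by positivity, by positivity, fun t d w R ht hR h1 h2 hw0 hw => ?_⟩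
  have hd : 0 < d := by nlinarith [sq_nonneg t]
  set A := t ^ 2 + (d ^ 2 + w ^ 2) with hA
  have hA0 : 0 < A := by positivity
  have hdR : d * R < 1 / 4 := by linarith
  have hd4 : d < 1 / 4 := by nlinarith
  have ht4 : t ^ 2 < 1 / 4 := by nlinarith [sq_nonneg t]
  have hA1 : A ≤ 3 / 8 := by nlinarith
  have hAR : A * R ^ 2 ≤ 3 / 8 := by
    have i1 : t ^ 2 * R * R ≤ d * R := by nlinarith
    have i2 : (d * R) ^ 2 ≤ (1 / 4) ^ 2 := pow_le_pow_left₀ (by positivity) hdR.le 2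
    have i3 : (w * R) ^ 2 ≤ (d * R) ^ 2 :=
      pow_le_pow_left₀ (by positivity) (by nlinarith) 2
    nlinarith
  constructor
  · have key := le_integral_H (α := A) (β := 2 * A)
      (m := (2 * A) ^ (-(3 / 2 : ℝ)) * Real.exp (-6) * (4 * A) ^ (-p))
      (integrableOn_HQ hp ht (R - d) R w) hA0 (by linarith) (by
        intro s hs1 hs2
        have hs : 0 < s := by linarith
        refine le_H hs hs2 ((Real.rpow_le_rpow_of_nonpos (by positivity)
          (by linarith : 2 * s ≤ 4 * A) (by linarith)).trans (le_var_rpow hp hs))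
          (by positivity) ?_
        have j1 : t ^ 2 / (4 * s) ≤ 1 / 4 := by
          rw [div_le_iff₀ (by positivity)]; nlinarith [sq_nonneg d, sq_nonneg w]
        have j2 : Q (R - d) R w s ≤ 7 / 2 * s := by
          have hexp := Real.add_one_le_exp (-s)
          have hexp1 : Real.exp (-s) ≤ 1 := by rw [Real.exp_le_one_iff]; linarith
          have k1 : ((1 - Real.exp (-s)) * R) ^ 2 ≤ (s * R) ^ 2 := by
            refine pow_le_pow_left₀ (mul_nonneg (by linarith) (by linarith)) ?_ 2
            exact mul_le_mul_of_nonneg_right (by linarith) (by linarith)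
          have k2 : (s * R) ^ 2 ≤ s * (3 / 4) := by
            have : s * R ^ 2 ≤ 3 / 4 := by nlinarith [sq_nonneg R]
            nlinarith
          have k3 : Q (R - d) R w s ≤ 2 * ((1 - Real.exp (-s)) * R) ^ 2 + 2 * d ^ 2 + w ^ 2 := by
            unfold Q
            nlinarith [sq_nonneg ((1 - Real.exp (-s)) * R + d)]
          nlinarith [sq_nonneg w, sq_nonneg t]
        have j3 : Q (R - d) R w s / var s ≤ 21 / 4 := by
          rw [div_le_iff₀ (var_pos hs)]
          linarith [le_var_of_le_one hs (by linarith)]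
        linarith)
    refine le_trans (le_of_eq ?_) key
    rw [Real.mul_rpow two_pos.le hA0.le, Real.mul_rpow four_pos.le hA0.le,
      show -(p + 1 / 2) = 1 + (-(3 / 2)) + (-p) by ring, Real.rpow_add hA0, Real.rpow_add hA0,
      Real.rpow_one]
    ring
  · have hi1 := integrableOn_add_rpow hA0 (q := p + 3 / 2) (by linarith)
    have hi2 := integrableOn_add_rpow one_pos (q := 3 / 2) (by norm_num)
    refine integral_H_le
      (g := fun s => D * ((s + A) ^ (-(p + 3 / 2)) + (s + 1) ^ (-(3 / 2 : ℝ))))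
      ((hi1.add hi2).const_mul D) (fun s hs => ?_) ?_
    · have e1 : 0 < (s + A) ^ (-(p + 3 / 2)) := by positivity
      have e2 : 0 < (s + 1) ^ (-(3 / 2 : ℝ)) := by positivity
      have hE := near_exponent hR hd h1 h2 hw0 hw hs
      have e3 : 0 < (2 : ℝ) ^ (3 / 2 : ℝ) := by positivity
      have e4 := Real.exp_pos (3 / 8)
      rw [hD, mul_assoc]
      rcases le_total s 1 with hs1 | hs1
      · refine (H_le_of_le_one hp hs hs1 hE).trans ?_
        refine mul_le_mul_of_nonneg_left ?_ hκ0.le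
        have h3 := h₁ s A hs hA0.le
        rw [neg_sub, sub_eq_add_neg, Real.exp_add]
        have h4 := mul_le_mul_of_nonneg_left h3 e4.le
        rw [← mul_assoc, ← mul_assoc] at h4
        have h5 : 0 < 2 ^ (3 / 2 : ℝ) * ((s + A) ^ (-(p + 3 / 2)) + (s + 1) ^ (-(3 / 2 : ℝ))) :=
          mul_pos e3 (add_pos e1 e2)
        have h6 := mul_pos (mul_pos e4 hC₁) e2
        linarith
      · refine (H_le_of_one_le hp hs1 (E := 0) (add_nonneg (by positivity)
          (div_nonneg (Q_nonneg _ _ _ _) (var_pos hs).le))).trans ?_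
        refine mul_le_mul_of_nonneg_left ?_ hκ0.le
        have h3 := rpow_le_add_one_rpow (k := 3 / 2) (by norm_num) hs1
        rw [neg_zero, Real.exp_zero, mul_one]
        have h5 : 0 < Real.exp (3 / 8) * C₁ *
            ((s + A) ^ (-(p + 3 / 2)) + (s + 1) ^ (-(3 / 2 : ℝ))) :=
          mul_pos (mul_pos e4 hC₁) (add_pos e1 e2)
        have h6 := mul_pos e3 e1
        linarith
    · rw [integral_const_mul, integral_add hi1 hi2, integral_add_rpow hA0 (by linarith),
        integral_add_rpow one_pos (by norm_num), Real.one_rpow, mul_assoc D]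
      refine mul_le_mul_of_nonneg_left ?_ hD0.le
      -- Times $s\ge1$ contribute only a constant, absorbed because $A\le 1$.
      have h3 : 1 ≤ A ^ (-(p + 1 / 2)) :=
        Real.one_le_rpow_of_pos_of_le_one_of_nonpos hA0 (by linarith) (by linarith)
      have h4 : A ^ (1 - (p + 3 / 2)) / (p + 3 / 2 - 1)
          = 1 / (p + 1 / 2) * A ^ (-(p + 1 / 2)) := by
        rw [show p + 3 / 2 - 1 = p + 1 / 2 by ring,
          show 1 - (p + 3 / 2) = -(p + 1 / 2) by ring]; ring
      rw [h4, add_mul]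
      norm_num
      norm_num at h3
      linarith

/-- The slope of $e^{-s}$ has absolute value at least $e^{-1}>1/3$ for $s\le1$. This makes the peak
at $s_0$ genuinely Gaussian. -/
lemma exp_neg_sub_sq_ge {s s₀ : ℝ} (hs : s ≤ 1) (hs₀ : s₀ ≤ 1) :
    (s - s₀) ^ 2 / 9 ≤ (Real.exp (-s₀) - Real.exp (-s)) ^ 2 := by
  wlog h : s ≤ s₀ generalizing s s₀
  · have := this hs₀ hs (not_le.1 h).le
    linarith [sq_nonneg (s - s₀), show (s₀ - s) ^ 2 = (s - s₀) ^ 2 by ring,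
      show (Real.exp (-s₀) - Real.exp (-s)) ^ 2 = (Real.exp (-s) - Real.exp (-s₀)) ^ 2 by ring]
  have h1 : Real.exp (-s) = Real.exp (-s₀) * Real.exp (s₀ - s) := by
    rw [← Real.exp_add]; congr 1; ring
  have h2 := Real.add_one_le_exp (s₀ - s)
  have h3 : 1 / 3 ≤ Real.exp (-s₀) := by
    have : Real.exp (-1) ≤ Real.exp (-s₀) := Real.exp_le_exp.2 (by linarith)
    refine le_trans ?_ this
    rw [Real.exp_neg, ← one_div]
    exact one_div_le_one_div_of_le (Real.exp_pos _) (by linarith [Real.exp_one_lt_d9])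
  have h4 : (s₀ - s) / 3 ≤ Real.exp (-s) - Real.exp (-s₀) := by
    rw [h1]; nlinarith
  have h5 := pow_le_pow_left₀ (by linarith) h4 2
  linarith [show ((s₀ - s) / 3) ^ 2 = (s - s₀) ^ 2 / 9 by ring,
      show (Real.exp (-s₀) - Real.exp (-s)) ^ 2 = (Real.exp (-s) - Real.exp (-s₀)) ^ 2 by ring]

lemma exp_neg_sub_le {s s₀ : ℝ} (h : s₀ ≤ s) (hs₀ : 0 ≤ s₀) :
    Real.exp (-s₀) - Real.exp (-s) ≤ s - s₀ := by
  have h1 : Real.exp (-s) = Real.exp (-s₀) * Real.exp (-(s - s₀)) := by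
    rw [← Real.exp_add]; congr 1; ring
  have h2 := Real.add_one_le_exp (-(s - s₀))
  have h3 : Real.exp (-s₀) ≤ 1 := by rw [Real.exp_le_one_iff]; linarith
  rw [h1]; nlinarith [Real.exp_pos (-s₀)]

lemma half_min_le {s : ℝ} (hs : 0 < s) (hs1 : s ≤ 1) : s / 2 ≤ 1 - Real.exp (-s) := by
  have h := exp_neg_le_inv hs
  have : 1 / (1 + s) ≤ 1 - s / 2 := by rw [div_le_iff₀ (by linarith)]; nlinarith
  linarith

lemma half_le {s : ℝ} (hs : 1 ≤ s) : 1 / 2 ≤ 1 - Real.exp (-s) := by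
  have h := half_min_le one_pos le_rfl
  have : Real.exp (-s) ≤ Real.exp (-1) := Real.exp_le_exp.2 (by linarith)
  linarith

set_option maxHeartbeats 800000 in
-- Laplace's method at $s_0=-\log(1-\sigma)\in[\sigma,\tfrac43\sigma]$: height $\sigma^{-(p+3/2)}$
-- times width $\sqrt\sigma/R$. The conditions $tR>1$ and $t^2<\sigma$ give $R^2\sigma>1$, so the
-- peak is narrower than its distance to $0$.
lemma integral_mid {p : ℝ} (hp : 0 ≤ p) : ∃ c C : ℝ, 0 < c ∧ 0 < C ∧ ∀ t σ w R : ℝ, 0 < t →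
    1 < R → 1 < t * R → t ^ 2 < σ → σ < 1 / 4 → w ^ 2 < σ →
    c * (R⁻¹ * σ ^ (-(p + 1))) ≤ ∫ s in Ioi (0 : ℝ), H p t (Q ((1 - σ) * R) R w) s ∧
    ∫ s in Ioi (0 : ℝ), H p t (Q ((1 - σ) * R) R w) s ≤ C * (R⁻¹ * σ ^ (-(p + 1))) := by
  obtain ⟨C₁, hC₁, h₁⟩ := rpow_neg_mul_exp_le (k := p + 3 / 2) (c := 1 / 8) (by linarith)
    (by norm_num)
  -- The power $k=1/2$ applied to $R^2$ or $R^2s$ yields exactly the factor $R^{-1}$ of the target.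
  obtain ⟨C₂, hC₂, h₂⟩ := exp_neg_le_rpow' (k := 1 / 2) (c := 1 / 32) (by norm_num)
    (by norm_num)
  set κ : ℝ := (2 / 3 : ℝ) ^ (-p) with hκ
  have hκ0 : 0 < κ := by positivity
  set D₁ : ℝ := (C₁ + C₂) * 2 ^ (p + 2) with hD₁
  set D₂ : ℝ := C₂ * 2 ^ (3 / 2 : ℝ) with hD₂
  set D₃ : ℝ := 2 ^ (p + 3 / 2) with hD₃
  have hD₁0 : 0 < D₁ := by positivity
  have hD₂0 : 0 < D₂ := by positivity
  have hD₃0 : 0 < D₃ := by positivity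
  refine ⟨3 ^ (-(3 / 2 : ℝ)) * Real.exp (-4) * 6 ^ (-p),
    κ * (D₁ * (1 / (p + 1)) + D₂ * 2 + D₃ * Real.sqrt (72 * Real.pi)),
    by positivity, by positivity, fun t σ w R ht hR htR h1 h2 hw => ?_⟩
  have hσ : 0 < σ := by nlinarith [sq_nonneg t]
  have hR0 : 0 < R := by linarith
  have hRσ : 1 < R ^ 2 * σ := by
    have : 1 < (t * R) ^ 2 := by nlinarith
    nlinarith [sq_nonneg R]
  set s₀ := -Real.log (1 - σ) with hs₀
  have hexp₀ : Real.exp (-s₀) = 1 - σ := by rw [hs₀, neg_neg, Real.exp_log (by linarith)]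
  have hs₀l : σ ≤ s₀ := by
    have := Real.log_le_sub_one_of_pos (show 0 < 1 - σ by linarith)
    rw [hs₀]; linarith
  have hs₀u : s₀ ≤ 4 / 3 * σ := by
    have h3 := Real.add_one_le_exp s₀
    have h4 : Real.exp s₀ = 1 / (1 - σ) := by
      rw [← hexp₀, Real.exp_neg s₀, one_div, inv_inv]
    have h5 : 1 / (1 - σ) ≤ 1 + 4 / 3 * σ := by
      rw [div_le_iff₀ (by linarith)]; nlinarith
    linarith
  have hQ : ∀ s, Q ((1 - σ) * R) R w s
      = R ^ 2 * (Real.exp (-s₀) - Real.exp (-s)) ^ 2 + w ^ 2 := by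
    intro s; rw [hexp₀]; unfold Q; ring
  have hQ' : ∀ s, R ^ 2 * (Real.exp (-s₀) - Real.exp (-s)) ^ 2 ≤ Q ((1 - σ) * R) R w s := by
    intro s; rw [hQ]; nlinarith [sq_nonneg w]
  constructor
  · have hsq := Real.sq_sqrt hσ.le
    have hsq0 : 0 < Real.sqrt σ := Real.sqrt_pos.2 hσ
    have hwid : Real.sqrt σ / R ≤ σ := by
      rw [div_le_iff₀ hR0]
      have : 1 < R * Real.sqrt σ := by
        by_contra hcon
        have := pow_le_pow_left₀ (by positivity) (not_lt.1 hcon) 2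
        rw [mul_pow, hsq] at this; linarith
      nlinarith
    have key := le_integral_H (α := s₀) (β := s₀ + Real.sqrt σ / R)
      (m := (3 * σ) ^ (-(3 / 2 : ℝ)) * Real.exp (-4) * (6 * σ) ^ (-p))
      (integrableOn_HQ hp ht ((1 - σ) * R) R w) (by linarith)
      (le_add_of_nonneg_right (by positivity)) (by
        intro s hs1 hs2
        have hs : 0 < s := by linarith
        refine le_H hs (by linarith) ((Real.rpow_le_rpow_of_nonpos (by positivity)
          (by linarith : 2 * s ≤ 6 * σ) (by linarith)).trans (le_var_rpow hp hs))
          (by positivity) ?_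
        have j1 : t ^ 2 / (4 * s) ≤ 1 / 4 := by
          rw [div_le_iff₀ (by positivity)]; linarith
        have j2 : Q ((1 - σ) * R) R w s ≤ 2 * s := by
          have k0 : Real.exp (-s) ≤ Real.exp (-s₀) := Real.exp_le_exp.2 (by linarith)
          have k1 := exp_neg_sub_le hs1 (by linarith)
          have k2 : R * (Real.exp (-s₀) - Real.exp (-s)) ≤ Real.sqrt σ := by
            have : Real.exp (-s₀) - Real.exp (-s) ≤ Real.sqrt σ / R := by linarith
            rw [le_div_iff₀ hR0] at this; linarith
          have k3 := pow_le_pow_left₀ (mul_nonneg hR0.le (by linarith)) k2 2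
          rw [hsq, mul_pow] at k3
          rw [hQ]; linarith
        have j3 : Q ((1 - σ) * R) R w s / var s ≤ 3 := by
          rw [div_le_iff₀ (var_pos hs)]
          linarith [le_var_of_le_one hs (by linarith)]
        linarith)
    refine le_trans (le_of_eq ?_) key
    rw [Real.mul_rpow (by norm_num) hσ.le, Real.mul_rpow (by norm_num) hσ.le,
      show -(p + 1) = 1 / 2 + (-(3 / 2)) + (-p) by ring, Real.rpow_add hσ, Real.rpow_add hσ,
      ← Real.sqrt_eq_rpow]
    ring
  · have hi1 := (integrableOn_add_rpow hσ (q := p + 2) (by linarith)).const_mul (D₁ * R⁻¹)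
    have hi2 := (integrableOn_add_rpow one_pos (q := 3 / 2) (by norm_num)).const_mul (D₂ * R⁻¹)
    have hb : 0 < R ^ 2 / (72 * σ) := by positivity
    have hi3 := ((integrable_gauss hb s₀).integrableOn (s := Ioi 0)).const_mul
      (D₃ * σ ^ (-(p + 3 / 2)))
    refine integral_H_le
      (g := fun s => κ * (D₁ * R⁻¹ * (s + σ) ^ (-(p + 2)) + D₂ * R⁻¹ * (s + 1) ^ (-(3 / 2 : ℝ))
        + D₃ * σ ^ (-(p + 3 / 2)) * Real.exp (-(R ^ 2 / (72 * σ) * (s - s₀) ^ 2))))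
      (((hi1.add hi2).add hi3).const_mul κ) (fun s hs => ?_) ?_
    · have e1 : 0 < D₁ * R⁻¹ * (s + σ) ^ (-(p + 2)) := by positivity
      have e2 : 0 < D₂ * R⁻¹ * (s + 1) ^ (-(3 / 2 : ℝ)) := by positivity
      have e3 : 0 < D₃ * σ ^ (-(p + 3 / 2)) * Real.exp (-(R ^ 2 / (72 * σ) * (s - s₀) ^ 2)) := by
        positivity
      have e4 : 0 ≤ t ^ 2 / (4 * s) := by positivity
      -- Four ranges: $s\ge1$, $s\le\sigma/2$, the peak $\sigma/2\le s\le4\sigma$, and $4\sigma\le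
      -- s\le1$. Off the peak, $|e^{-s_0}-e^{-s}|$ is at least of order $1$, $\sigma$ and $s$
      -- respectively.
      rcases le_total 1 s with hs1 | hs1
      · have hE : 1 / 32 * R ^ 2 ≤ t ^ 2 / (4 * s) + Q ((1 - σ) * R) R w s / var s := by
          have k1 := half_le hs1
          have k2 : 1 / 32 * R ^ 2 ≤ R ^ 2 * (Real.exp (-s₀) - Real.exp (-s)) ^ 2 := by
            have : 1 / 4 ≤ Real.exp (-s₀) - Real.exp (-s) := by rw [hexp₀]; linarith
            linarith [sq_mul_sq_le R (by norm_num) this, sq_nonneg R]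
          linarith [le_div_var hs (k2.trans (hQ' s)) (Q_nonneg _ _ _ _)]
        refine (H_le_of_one_le hp hs1 hE).trans ?_
        refine mul_le_mul_of_nonneg_left ?_ hκ0.le
        refine le_trans (b := D₂ * R⁻¹ * (s + 1) ^ (-(3 / 2 : ℝ))) ?_ (by linarith)
        have k3 := h₂ (R ^ 2) (by positivity)
        rw [sq_rpow_neg_half hR0] at k3
        calc _ ≤ (2 ^ (3 / 2 : ℝ) * (s + 1) ^ (-(3 / 2 : ℝ))) * (C₂ * R⁻¹) := by
              gcongr
              exact rpow_le_add_one_rpow (by norm_num) hs1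
          _ = _ := by rw [hD₂]; ring
      rcases le_total s (σ / 2) with hsσ | hsσ
      · have hE : 1 / 8 * (R ^ 2 * σ ^ 2 / s)
            ≤ t ^ 2 / (4 * s) + Q ((1 - σ) * R) R w s / var s := by
          have k2 : R ^ 2 * σ ^ 2 / 4 ≤ R ^ 2 * (Real.exp (-s₀) - Real.exp (-s)) ^ 2 := by
            have : σ / 2 ≤ Real.exp (-s) - Real.exp (-s₀) := by
              rw [hexp₀]; linarith [Real.add_one_le_exp (-s)]
            rw [← neg_sub (Real.exp (-s)), neg_sq]
            linarith [sq_mul_sq_le R (by positivity) this, sq_nonneg R]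
          have k3 := div_two_mul_le hs (k2.trans (hQ' s)) (Q_nonneg _ _ _ _)
          have k4 : R ^ 2 * σ ^ 2 / 4 / (2 * s) = 1 / 8 * (R ^ 2 * σ ^ 2 / s) := by
            field_simp; norm_num
          linarith
        refine (H_le_of_le_one hp hs hs1 hE).trans ?_
        refine mul_le_mul_of_nonneg_left ?_ hκ0.le
        refine le_trans (b := D₁ * R⁻¹ * (s + σ) ^ (-(p + 2))) ?_ (by linarith)
        refine (h₁ s (R ^ 2 * σ ^ 2) hs (by positivity)).trans ?_
        have k1 : (s + R ^ 2 * σ ^ 2) ^ (-(p + 3 / 2)) ≤ R⁻¹ * σ ^ (-(p + 2)) := by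
          calc (s + R ^ 2 * σ ^ 2) ^ (-(p + 3 / 2)) ≤ (R ^ 2 * σ * σ) ^ (-(p + 3 / 2)) :=
                Real.rpow_le_rpow_of_nonpos (by positivity) (by nlinarith) (by linarith)
            _ = (R ^ 2 * σ) ^ (-(p + 3 / 2)) * σ ^ (-(p + 3 / 2)) :=
                Real.mul_rpow (by positivity) hσ.le
            -- Since $R^2\sigma>1$, its exponent may be weakened to $-1/2$, leaving a single
            -- $R^{-1}$.
            _ ≤ (R ^ 2 * σ) ^ (-(1 / 2 : ℝ)) * σ ^ (-(p + 3 / 2)) := by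
                gcongr
                · exact hRσ.le
                · linarith
            _ = R⁻¹ * σ ^ (-(p + 2)) := by
                rw [Real.mul_rpow (by positivity) hσ.le, sq_rpow_neg_half hR0, mul_assoc,
                  ← Real.rpow_add hσ]
                congr 2; ring
        have k2 : σ ^ (-(p + 2)) ≤ 2 ^ (p + 2) * (s + σ) ^ (-(p + 2)) :=
          rpow_neg_le_mul_rpow_neg (by linarith) two_pos hσ (by linarith) (by linarith)
        calc C₁ * (s + R ^ 2 * σ ^ 2) ^ (-(p + 3 / 2))
            ≤ (C₁ + C₂) * (R⁻¹ * (2 ^ (p + 2) * (s + σ) ^ (-(p + 2)))) := by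
              gcongr
              · linarith
              · exact k1.trans (by gcongr)
          _ = _ := by rw [hD₁]; ring
      rcases le_total s (4 * σ) with hsσ' | hsσ'
      · have hE : R ^ 2 / (72 * σ) * (s - s₀) ^ 2
            ≤ t ^ 2 / (4 * s) + Q ((1 - σ) * R) R w s / var s := by
          have k2 : R ^ 2 * ((s - s₀) ^ 2 / 9) ≤ R ^ 2 * (Real.exp (-s₀) - Real.exp (-s)) ^ 2 :=
            mul_le_mul_of_nonneg_left (exp_neg_sub_sq_ge hs1 (by linarith)) (sq_nonneg R)
          have k3 := div_two_mul_le hs (k2.trans (hQ' s)) (Q_nonneg _ _ _ _)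
          have k4 : R ^ 2 / (72 * σ) * (s - s₀) ^ 2 ≤ R ^ 2 * ((s - s₀) ^ 2 / 9) / (2 * s) := by
            have : R ^ 2 / (72 * σ) * (s - s₀) ^ 2
              = R ^ 2 * ((s - s₀) ^ 2 / 9) / (2 * (4 * σ)) := by field_simp; ring
            rw [this]
            gcongr
          linarith
        refine (H_le_of_le_one hp hs hs1 hE).trans ?_
        refine mul_le_mul_of_nonneg_left ?_ hκ0.le
        refine le_trans (b := D₃ * σ ^ (-(p + 3 / 2)) *
          Real.exp (-(R ^ 2 / (72 * σ) * (s - s₀) ^ 2))) ?_ (by linarith)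
        gcongr
        exact rpow_neg_le_mul_rpow_neg (by linarith) two_pos hs hσ (by linarith)
      · have hE : 1 / 32 * (R ^ 2 * s)
            ≤ t ^ 2 / (4 * s) + Q ((1 - σ) * R) R w s / var s := by
          have k1 := half_min_le hs hs1
          have k2 : R ^ 2 * s ^ 2 / 16 ≤ R ^ 2 * (Real.exp (-s₀) - Real.exp (-s)) ^ 2 := by
            have : s / 4 ≤ Real.exp (-s₀) - Real.exp (-s) := by rw [hexp₀]; linarith
            linarith [sq_mul_sq_le R (by positivity) this, sq_nonneg R]
          have k3 := div_two_mul_le hs (k2.trans (hQ' s)) (Q_nonneg _ _ _ _)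
          have k4 : R ^ 2 * s ^ 2 / 16 / (2 * s) = 1 / 32 * (R ^ 2 * s) := by
            field_simp; norm_num
          linarith
        refine (H_le_of_le_one hp hs hs1 hE).trans ?_
        refine mul_le_mul_of_nonneg_left ?_ hκ0.le
        refine le_trans (b := D₁ * R⁻¹ * (s + σ) ^ (-(p + 2))) ?_ (by linarith)
        have k1 := h₂ (R ^ 2 * s) (by positivity)
        rw [Real.mul_rpow (by positivity) hs.le, sq_rpow_neg_half hR0] at k1
        have k2 : s ^ (-(p + 2)) ≤ 2 ^ (p + 2) * (s + σ) ^ (-(p + 2)) :=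
          rpow_neg_le_mul_rpow_neg (by linarith) two_pos hs (by linarith) (by linarith)
        calc s ^ (-(p + 3 / 2)) * Real.exp (-(1 / 32 * (R ^ 2 * s)))
            ≤ s ^ (-(p + 3 / 2)) * (C₂ * (R⁻¹ * s ^ (-(1 / 2 : ℝ)))) := by gcongr
          _ = C₂ * (R⁻¹ * s ^ (-(p + 2))) := by
              rw [show -(p + 2) = -(p + 3 / 2) + -(1 / 2 : ℝ) by ring, Real.rpow_add hs]; ring
          _ ≤ (C₁ + C₂) * (R⁻¹ * (2 ^ (p + 2) * (s + σ) ^ (-(p + 2)))) := by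
              gcongr
              linarith
          _ = _ := by rw [hD₁]; ring
    · have hi12 : IntegrableOn (fun s => D₁ * R⁻¹ * (s + σ) ^ (-(p + 2))
        + D₂ * R⁻¹ * (s + 1) ^ (-(3 / 2 : ℝ))) (Ioi 0) := hi1.add hi2
      rw [integral_const_mul, integral_add hi12 hi3, integral_add hi1 hi2,
        integral_const_mul, integral_const_mul, integral_const_mul,
        integral_add_rpow hσ (by linarith), integral_add_rpow one_pos (by norm_num),
        Real.one_rpow, mul_assoc κ]
      refine mul_le_mul_of_nonneg_left ?_ hκ0.le
      have h3 : 1 ≤ σ ^ (-(p + 1)) :=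
        Real.one_le_rpow_of_pos_of_le_one_of_nonpos hσ (by linarith) (by linarith)
      have h4 := integral_gauss_le hb s₀
      have h5 : Real.sqrt (Real.pi / (R ^ 2 / (72 * σ)))
          = Real.sqrt (72 * Real.pi) * (σ ^ (1 / 2 : ℝ) * R⁻¹) := by
        rw [show Real.pi / (R ^ 2 / (72 * σ)) = (72 * Real.pi) * (σ / R ^ 2) by field_simp,
          Real.sqrt_mul (by positivity), Real.sqrt_div hσ.le, Real.sqrt_sq hR0.le,
          ← Real.sqrt_eq_rpow, div_eq_mul_inv]
      rw [h5] at h4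
      have h6 : D₃ * σ ^ (-(p + 3 / 2)) *
          ∫ s in Ioi (0 : ℝ), Real.exp (-(R ^ 2 / (72 * σ) * (s - s₀) ^ 2))
          ≤ D₃ * Real.sqrt (72 * Real.pi) * (R⁻¹ * σ ^ (-(p + 1))) := by
        calc _ ≤ D₃ * σ ^ (-(p + 3 / 2)) *
              (Real.sqrt (72 * Real.pi) * (σ ^ (1 / 2 : ℝ) * R⁻¹)) := by gcongr
          _ = _ := by
            rw [show -(p + 1) = -(p + 3 / 2) + 1 / 2 by ring, Real.rpow_add hσ]; ring
      have h7 : D₁ * R⁻¹ * (σ ^ (1 - (p + 2)) / (p + 2 - 1))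
          = D₁ * (1 / (p + 1)) * (R⁻¹ * σ ^ (-(p + 1))) := by
        rw [show p + 2 - 1 = p + 1 by ring, show 1 - (p + 2) = -(p + 1) by ring]; ring
      have h8 : D₂ * R⁻¹ * (1 / (3 / 2 - 1)) ≤ D₂ * 2 * (R⁻¹ * σ ^ (-(p + 1))) := by
        have : D₂ * R⁻¹ * (1 / (3 / 2 - 1)) = D₂ * 2 * (R⁻¹ * 1) := by ring
        rw [this]; gcongr
      rw [h7, add_mul, add_mul]
      linarith

/-- On the window $[t^2,2t^2]$ both exponents are bounded and the variance is of order 1, so the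
size is $t^2\cdot(t^2)^{-3/2}$. In the majorant, the small-time term $(t^2)^{-(p+1/2)}$ is no larger
because $t\ge1$. -/
lemma integral_large_t {p : ℝ} (hp : 0 ≤ p) : ∃ c C : ℝ, 0 < c ∧ 0 < C ∧
    ∀ (t : ℝ) (q : ℝ → ℝ), 1 ≤ t → Measurable q → (∀ s, 0 < s → 0 ≤ q s ∧ q s ≤ 4) →
    c * t⁻¹ ≤ ∫ s in Ioi (0 : ℝ), H p t q s ∧ ∫ s in Ioi (0 : ℝ), H p t q s ≤ C * t⁻¹ := by
  obtain ⟨D, hD, h⟩ := H_le_general hp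
  refine ⟨2 ^ (-(3 / 2 : ℝ)) * Real.exp (-7), D * (1 / (p + 1 / 2) + 2), by positivity,
    by positivity, fun t q ht hqm hq => ?_⟩
  have ht0 : 0 < t := by linarith
  have ht2 : 1 ≤ t ^ 2 := by nlinarith
  have hti : (t ^ 2) ^ (-(1 / 2 : ℝ)) = t⁻¹ := sq_rpow_neg_half ht0
  constructor
  · have key := le_integral_H (α := t ^ 2) (β := 2 * t ^ 2)
      (m := (2 * t ^ 2) ^ (-(3 / 2 : ℝ)) * Real.exp (-7) * 1)
      (integrableOn_H hp ht0 hqm fun s hs => (hq s hs).1) (by positivity) (by linarith) (by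
        intro s hs1 hs2
        have hs : 0 < s := by linarith
        refine le_H hs hs2 (one_le_var_rpow hp hs) zero_le_one ?_
        have j1 : t ^ 2 / (4 * s) ≤ 1 / 4 := by
          rw [div_le_iff₀ (by positivity)]; linarith
        have j3 : q s / var s ≤ 6 := by
          rw [div_le_iff₀ (var_pos hs)]
          linarith [le_var_of_one_le (ht2.trans hs1), (hq s hs).2]
        linarith)
    refine le_trans (le_of_eq ?_) key
    rw [Real.mul_rpow two_pos.le (by positivity), ← hti,
      show -(1 / 2 : ℝ) = 1 + -(3 / 2) by norm_num, Real.rpow_add (by positivity),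
      Real.rpow_one]
    ring
  · have hi1 := integrableOn_add_rpow (A := t ^ 2) (by positivity) (q := p + 3 / 2) (by linarith)
    have hi2 := integrableOn_add_rpow (A := t ^ 2) (by positivity) (q := 3 / 2) (by norm_num)
    refine integral_H_le ((hi1.add hi2).const_mul D)
      (fun s hs => h t q ht0 (fun s hs => (hq s hs).1) s hs) ?_
    simp only [Pi.add_apply]
    rw [integral_const_mul, integral_add hi1 hi2, integral_add_rpow (by positivity) (by linarith),
      integral_add_rpow (by positivity) (by norm_num), mul_assoc]
    refine mul_le_mul_of_nonneg_left ?_ hD.le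
    have k1 : (t ^ 2) ^ (1 - (p + 3 / 2)) ≤ t⁻¹ := by
      rw [← hti]
      exact Real.rpow_le_rpow_of_exponent_le ht2 (by linarith)
    have k2 : (t ^ 2) ^ (1 - (3 / 2 : ℝ)) / (3 / 2 - 1) = 2 * t⁻¹ := by
      rw [← hti]; norm_num; ring
    rw [k2, add_mul, show p + 3 / 2 - 1 = p + 1 / 2 by ring, one_div_mul_eq_div]
    gcongr

set_option maxHeartbeats 800000 in
-- With $R=ae^{s_0}$ the exponent is $a^2(1-e^{-(s-s_0)})^2+w^2$ up to the variance, which is of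
-- order 1 near $s_0\ge4$. Thus the peak has width $1/a$ and height $s_0^{-3/2}$; $t^2\le s_0$ keeps
-- $e^{-t^2/(4s)}$ bounded below there.
lemma integral_far {p : ℝ} (hp : 0 ≤ p) : ∃ c C : ℝ, 0 < c ∧ 0 < C ∧ ∀ t a w s₀ : ℝ, 0 < t →
    1 ≤ a → 4 ≤ s₀ → s₀ ≤ a → t ^ 2 ≤ s₀ → w ^ 2 ≤ 1 →
    c * (s₀ ^ (-(3 / 2 : ℝ)) * a⁻¹)
      ≤ ∫ s in Ioi (0 : ℝ), H p t (Q a (a * Real.exp s₀) w) s ∧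
    ∫ s in Ioi (0 : ℝ), H p t (Q a (a * Real.exp s₀) w) s
      ≤ C * (s₀ ^ (-(3 / 2 : ℝ)) * a⁻¹) := by
  obtain ⟨C₁, hC₁, h₁⟩ := rpow_neg_mul_exp_le (k := p + 3 / 2) (c := 1) (by linarith)
    one_pos
  -- The choice $5/4$ gives $(a^2)^{-5/4}=a^{-3/2}a^{-1}\le s_0^{-3/2}a^{-1}$, using $s_0\le a$.
  obtain ⟨C₂, hC₂, h₂⟩ := exp_neg_le_rpow' (k := 5 / 4) (c := 1 / 4) (by norm_num)
    (by norm_num)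
  set κ : ℝ := (2 / 3 : ℝ) ^ (-p) with hκ
  have hκ0 : 0 < κ := by positivity
  set D₁ : ℝ := C₁ + 2 ^ (3 / 2 : ℝ) with hD₁
  set D₂ : ℝ := 2 ^ (3 / 2 : ℝ) with hD₂
  have hD₂0 : 0 < D₂ := by positivity
  have hD₁0 : 0 < D₁ := by positivity
  refine ⟨2 ^ (-(3 / 2 : ℝ)) * Real.exp (-4),
    κ * (D₁ * C₂ * 2 + D₂ * Real.sqrt (4 * Real.pi)),
    by positivity, by positivity, fun t a w s₀ ht ha hs₀ hs₀a h1 hw => ?_⟩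
  have ha0 : 0 < a := by linarith
  have hs₀0 : 0 < s₀ := by linarith
  have hQ : ∀ s, Q a (a * Real.exp s₀) w s
      = a ^ 2 * (1 - Real.exp (-(s - s₀))) ^ 2 + w ^ 2 := by
    intro s
    have : Real.exp (-(s - s₀)) = Real.exp (-s) * Real.exp s₀ := by
      rw [← Real.exp_add]; congr 1; ring
    rw [this]; unfold Q; ring
  have hQ' : ∀ s, a ^ 2 * (1 - Real.exp (-(s - s₀))) ^ 2 ≤ Q a (a * Real.exp s₀) w s := by
    intro s; rw [hQ]; nlinarith [sq_nonneg w]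
  constructor
  · have hainv : a⁻¹ ≤ 1 := inv_le_one_of_one_le₀ ha
    have key := le_integral_H (α := s₀) (β := s₀ + a⁻¹)
      (m := (2 * s₀) ^ (-(3 / 2 : ℝ)) * Real.exp (-4) * 1)
      (integrableOn_HQ hp ht a (a * Real.exp s₀) w) hs₀0
      (le_add_of_nonneg_right (by positivity)) (by
        intro s hs1 hs2
        have hs : 0 < s := by linarith
        refine le_H hs (by linarith) (one_le_var_rpow hp hs) zero_le_one ?_
        have j1 : t ^ 2 / (4 * s) ≤ 1 / 4 := by
          rw [div_le_iff₀ (by positivity)]; linarith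
        have j2 : Q a (a * Real.exp s₀) w s ≤ 2 := by
          have k0 : Real.exp (-(s - s₀)) ≤ 1 := by rw [Real.exp_le_one_iff]; linarith
          have k1 := Real.add_one_le_exp (-(s - s₀))
          have k2 : a * (1 - Real.exp (-(s - s₀))) ≤ 1 := by
            calc a * (1 - Real.exp (-(s - s₀))) ≤ a * a⁻¹ := by
                  gcongr; linarith
              _ = 1 := mul_inv_cancel₀ ha0.ne'
          have k3 := pow_le_pow_left₀ (mul_nonneg ha0.le (by linarith)) k2 2
          rw [mul_pow] at k3
          rw [hQ]; linarith
        have j3 : Q a (a * Real.exp s₀) w s / var s ≤ 3 := by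
          rw [div_le_iff₀ (var_pos hs)]
          linarith [le_var_of_one_le (show 1 ≤ s by linarith)]
        linarith)
    refine le_trans (le_of_eq ?_) key
    rw [Real.mul_rpow (by norm_num) hs₀0.le]
    ring
  · have hi1 := (integrableOn_add_rpow one_pos (q := 3 / 2) (by norm_num)).const_mul
      (D₁ * Real.exp (-(1 / 4 * a ^ 2)))
    have hb : 0 < 1 / 4 * a ^ 2 := by positivity
    have hi2 := ((integrable_gauss hb s₀).integrableOn (s := Ioi 0)).const_mul
      (D₂ * s₀ ^ (-(3 / 2 : ℝ)))
    refine integral_H_le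
      (g := fun s => κ * (D₁ * Real.exp (-(1 / 4 * a ^ 2)) * (s + 1) ^ (-(3 / 2 : ℝ))
        + D₂ * s₀ ^ (-(3 / 2 : ℝ)) * Real.exp (-(1 / 4 * a ^ 2 * (s - s₀) ^ 2))))
      ((hi1.add hi2).const_mul κ) (fun s hs => ?_) ?_
    · have e1 : 0 < D₁ * Real.exp (-(1 / 4 * a ^ 2)) * (s + 1) ^ (-(3 / 2 : ℝ)) := by positivity
      have e2 : 0 < D₂ * s₀ ^ (-(3 / 2 : ℝ)) * Real.exp (-(1 / 4 * a ^ 2 * (s - s₀) ^ 2)) := by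
        positivity
      have e4 : 0 ≤ t ^ 2 / (4 * s) := by positivity
      -- Shared by both sides of the peak: away from $s_0$ the integrand carries the factor
      -- $e^{-a^2/4}$.
      have tail : 1 ≤ s → 1 / 4 * a ^ 2 ≤ Q a (a * Real.exp s₀) w s →
          H p t (Q a (a * Real.exp s₀) w) s ≤
            κ * (D₁ * Real.exp (-(1 / 4 * a ^ 2)) * (s + 1) ^ (-(3 / 2 : ℝ))
              + D₂ * s₀ ^ (-(3 / 2 : ℝ)) * Real.exp (-(1 / 4 * a ^ 2 * (s - s₀) ^ 2))) := by
        intro hs1 k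
        refine (H_le_of_one_le hp hs1 (E := 1 / 4 * a ^ 2) ?_).trans ?_
        · linarith [le_div_var hs k (Q_nonneg _ _ _ _)]
        refine mul_le_mul_of_nonneg_left ?_ hκ0.le
        refine le_trans (b := D₁ * Real.exp (-(1 / 4 * a ^ 2)) * (s + 1) ^ (-(3 / 2 : ℝ))) ?_
          (by linarith)
        calc s ^ (-(3 / 2 : ℝ)) * Real.exp (-(1 / 4 * a ^ 2))
            ≤ (D₁ * (s + 1) ^ (-(3 / 2 : ℝ))) * Real.exp (-(1 / 4 * a ^ 2)) := by
              gcongr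
              refine (rpow_le_add_one_rpow (by norm_num) hs1).trans ?_
              gcongr
              linarith
          _ = _ := by ring
      rcases le_total (s₀ + 1) s with hu | hu
      · refine tail (by linarith) (le_trans ?_ (hQ' s))
        have k1 := half_le (show 1 ≤ s - s₀ by linarith)
        linarith [sq_mul_sq_le a (by norm_num) k1, sq_nonneg a]
      rcases le_total (s₀ / 2) s with hl | hl
      · refine (H_le_of_one_le hp (by linarith) (E := 1 / 4 * a ^ 2 * (s - s₀) ^ 2) ?_).trans ?_
        · have k1 : (s - s₀) ^ 2 / 4 ≤ (1 - Real.exp (-(s - s₀))) ^ 2 := by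
            rcases lt_or_ge 0 (s - s₀) with h0 | h0
            · have := half_min_le h0 (by linarith)
              have := pow_le_pow_left₀ (by linarith) this 2
              linarith [show ((s - s₀) / 2) ^ 2 = (s - s₀) ^ 2 / 4 by ring]
            · have k2 := Real.add_one_le_exp (-(s - s₀))
              nlinarith
          have k2 : 1 / 4 * a ^ 2 * (s - s₀) ^ 2 ≤ Q a (a * Real.exp s₀) w s := by
            refine le_trans ?_ (hQ' s)
            nlinarith [sq_nonneg a]
          linarith [le_div_var hs k2 (Q_nonneg _ _ _ _)]
        refine mul_le_mul_of_nonneg_left ?_ hκ0.le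
        refine le_trans (b := D₂ * s₀ ^ (-(3 / 2 : ℝ)) *
          Real.exp (-(1 / 4 * a ^ 2 * (s - s₀) ^ 2))) ?_ (by linarith)
        gcongr
        exact rpow_neg_le_mul_rpow_neg (by norm_num) two_pos hs hs₀0 (by linarith)
      · have k1 : 4 * a ^ 2 ≤ Q a (a * Real.exp s₀) w s := by
          refine le_trans ?_ (hQ' s)
          have k2 : 2 ≤ Real.exp (-(s - s₀)) - 1 := by
            have := Real.add_one_le_exp (-(s - s₀) / 2)
            have h3 : Real.exp (-(s - s₀)) = Real.exp (-(s - s₀) / 2) ^ 2 := by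
              rw [← Real.exp_nat_mul]; congr 1; push_cast; ring
            rw [h3]; nlinarith
          rw [← neg_sub (Real.exp (-(s - s₀))), neg_sq]
          linarith [sq_mul_sq_le a (by norm_num) k2, sq_nonneg a]
        rcases le_total 1 s with hs1 | hs1
        · exact tail hs1 (by linarith [sq_nonneg a])
        refine (H_le_of_le_one hp hs hs1 (E := 1 / 4 * a ^ 2 + 1 * (1 / s)) ?_).trans ?_
        · have k2 := div_two_mul_le hs k1 (Q_nonneg _ _ _ _)
          have k3 : 4 * a ^ 2 / (2 * s) = a ^ 2 * (1 / s) + a ^ 2 * (1 / s) := by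
            field_simp; norm_num
          have k4 : 1 ≤ 1 / s := by rw [le_div_iff₀ hs]; linarith
          have k5 : 1 ≤ a ^ 2 := one_le_pow₀ ha
          have k6 : a ^ 2 * 1 ≤ a ^ 2 * (1 / s) := by gcongr
          have k7 : 1 * (1 / s) ≤ a ^ 2 * (1 / s) := by gcongr
          linarith
        refine mul_le_mul_of_nonneg_left ?_ hκ0.le
        refine le_trans (b := D₁ * Real.exp (-(1 / 4 * a ^ 2)) * (s + 1) ^ (-(3 / 2 : ℝ))) ?_
          (by linarith)
        rw [neg_add (1 / 4 * a ^ 2), Real.exp_add]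
        have k2 := h₁ s 1 hs zero_le_one
        calc s ^ (-(p + 3 / 2)) * (Real.exp (-(1 / 4 * a ^ 2)) * Real.exp (-(1 * (1 / s))))
            = Real.exp (-(1 / 4 * a ^ 2)) *
              (s ^ (-(p + 3 / 2)) * Real.exp (-(1 * (1 / s)))) := by ring
          _ ≤ Real.exp (-(1 / 4 * a ^ 2)) * (D₁ * (s + 1) ^ (-(3 / 2 : ℝ))) := by
              refine mul_le_mul_of_nonneg_left (k2.trans ?_) (Real.exp_pos _).le
              gcongr
              · linarith
              · linarith
              · linarith
          _ = _ := by ring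
    · rw [integral_const_mul, integral_add hi1 hi2, integral_const_mul, integral_const_mul,
        integral_add_rpow one_pos (by norm_num), Real.one_rpow, mul_assoc κ]
      refine mul_le_mul_of_nonneg_left ?_ hκ0.le
      have h4 := integral_gauss_le hb s₀
      have h5 : Real.sqrt (Real.pi / (1 / 4 * a ^ 2)) = Real.sqrt (4 * Real.pi) * a⁻¹ := by
        rw [show Real.pi / (1 / 4 * a ^ 2) = (4 * Real.pi) / a ^ 2 by field_simp,
          Real.sqrt_div (by positivity), Real.sqrt_sq ha0.le, div_eq_mul_inv]
      rw [h5] at h4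
      have h6 : Real.exp (-(1 / 4 * a ^ 2)) ≤ C₂ * (s₀ ^ (-(3 / 2 : ℝ)) * a⁻¹) := by
        refine (h₂ (a ^ 2) (by positivity)).trans ?_
        gcongr C₂ * ?_
        have : (a ^ 2) ^ (-(5 / 4 : ℝ)) = a ^ (-(3 / 2 : ℝ)) * a⁻¹ := by
          rw [← Real.rpow_natCast, ← Real.rpow_mul ha0.le, ← Real.rpow_neg_one a,
            ← Real.rpow_add ha0]
          norm_num
        rw [this]
        gcongr ?_ * _
        exact Real.rpow_le_rpow_of_nonpos hs₀0 hs₀a (by norm_num)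
      rw [add_mul (D₁ * C₂ * 2)]
      refine add_le_add ?_ ?_
      · calc D₁ * Real.exp (-(1 / 4 * a ^ 2)) * (1 / (3 / 2 - 1))
            = D₁ * Real.exp (-(1 / 4 * a ^ 2)) * 2 := by norm_num
          _ ≤ D₁ * (C₂ * (s₀ ^ (-(3 / 2 : ℝ)) * a⁻¹)) * 2 := by gcongr
          _ = _ := by ring
      · calc _ ≤ D₂ * s₀ ^ (-(3 / 2 : ℝ)) * (Real.sqrt (4 * Real.pi) * a⁻¹) := by gcongr
          _ = _ := by ring

/-! ### Reduction of `P` to the scalar integral -/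

variable {n : ℕ}

lemma P_eq (t : ℝ) (x y : Rn n) : P t x y = 1 / (2 * Real.pi ^ (((n : ℝ) + 1) / 2)) *
    (t * ∫ s in Ioi (0 : ℝ), H ((n : ℝ) / 2) t (fun s => ‖y - Real.exp (-s) • x‖ ^ 2) s) := by
  rw [P, ← integral_const_mul t]
  congr 1
  refine setIntegral_congr_fun measurableSet_Ioi fun s hs => ?_
  have hs0 : (0 : ℝ) ≤ s := le_of_lt hs
  have hv : 0 ≤ var s := (var_pos hs).le
  simp only [H, mehler]
  rw [Real.rpow_neg hs0, Real.rpow_neg hv, var]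
  ring

lemma norm_par {x y : Rn n} (h : 0 < inner ℝ x y) : ‖par x y‖ = inner ℝ x y / ‖x‖ := by
  have hx : x ≠ 0 := by rintro rfl; simp at h
  have hx' : 0 < ‖x‖ := norm_pos_iff.2 hx
  rw [par, if_neg hx, norm_smul, Real.norm_of_nonneg (by positivity)]
  field_simp

lemma norm_sub_smul_sq {x y : Rn n} (h : 0 < inner ℝ x y) (r : ℝ) :
    ‖y - r • x‖ ^ 2 = (‖par x y‖ - r * ‖x‖) ^ 2 + ‖perp x y‖ ^ 2 := by
  have hx : x ≠ 0 := by rintro rfl; simp at h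
  have hx' : 0 < ‖x‖ := norm_pos_iff.2 hx
  have key : ∀ r : ℝ, ‖y - r • x‖ ^ 2 = ‖y‖ ^ 2 - 2 * (r * inner ℝ x y) + r ^ 2 * ‖x‖ ^ 2 := by
    intro r
    rw [norm_sub_sq_real, inner_smul_right, real_inner_comm, norm_smul, mul_pow,
      Real.norm_eq_abs, sq_abs]
  have hperp : perp x y = y - (inner ℝ x y / ‖x‖ ^ 2) • x := by rw [perp, par, if_neg hx]
  -- The norm of the orthogonal part is the same quadratic evaluated at its minimizer $r=\langle
  -- x,y\rangle/|x|^2$.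
  rw [norm_par h, hperp, key, key]
  field_simp
  ring

lemma norm_sub_sq_eq {x y : Rn n} (h : 0 < inner ℝ x y) :
    ‖x - y‖ ^ 2 = (‖x‖ - ‖par x y‖) ^ 2 + ‖perp x y‖ ^ 2 := by
  have := norm_sub_smul_sq h 1
  rw [one_smul, norm_sub_rev] at this
  rw [this]; ring

lemma norm_sub_par {x y : Rn n} (h : 0 < inner ℝ x y) (hle : ‖par x y‖ ≤ ‖x‖) :
    ‖x - par x y‖ = ‖x‖ - ‖par x y‖ := by
  have hx : x ≠ 0 := by rintro rfl; simp at h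
  have hx' : 0 < ‖x‖ := norm_pos_iff.2 hx
  rw [norm_par h] at hle ⊢
  have e : x - par x y = (1 - inner ℝ x y / ‖x‖ / ‖x‖) • x := by
    rw [par, if_neg hx, sub_smul, one_smul, div_div, sq]
  rw [e, norm_smul, Real.norm_of_nonneg]
  · field_simp
  · rw [sub_nonneg]; exact div_le_one_of_le₀ hle hx'.le

lemma P_eq_Q {x y : Rn n} (t : ℝ) (h : 0 < inner ℝ x y) :
    P t x y = 1 / (2 * Real.pi ^ (((n : ℝ) + 1) / 2)) *
      (t * ∫ s in Ioi (0 : ℝ), H ((n : ℝ) / 2) t (Q ‖par x y‖ ‖x‖ ‖perp x y‖) s) := by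
  have : (fun s => ‖y - Real.exp (-s) • x‖ ^ 2) = Q ‖par x y‖ ‖x‖ ‖perp x y‖ := by
    funext s; exact norm_sub_smul_sq h _
  rw [P_eq, this]

/-- Comparability passes through a profile $G$ without exponential factors: the integral $I$ is
compared with $G$, and the kernel with $tG$. -/
lemma comparable_of_bounds {S : Set (ℝ × Rn n × Rn n)} {κ : ℝ → Rn n → Rn n → ℝ}
    {c C e f : ℝ} (hc : 0 < c) (hC : 0 < C) (he : 0 < e) (hf : 0 < f)
    (h : ∀ t x y, (t, x, y) ∈ S → ∃ I G : ℝ,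
      P t x y = 1 / (2 * Real.pi ^ (((n : ℝ) + 1) / 2)) * (t * I) ∧ 0 < t ∧ 0 ≤ G ∧
      (c * G ≤ I ∧ I ≤ C * G) ∧ e * (t * G) ≤ κ t x y ∧ κ t x y ≤ f * (t * G)) :
    ∃ D : ℝ, 0 < D ∧ ∀ t x y, (t, x, y) ∈ S → D⁻¹ * κ t x y ≤ P t x y ∧ P t x y ≤ D * κ t x y := by
  have hN : 0 < 1 / (2 * Real.pi ^ (((n : ℝ) + 1) / 2)) := by positivity
  set N := 1 / (2 * Real.pi ^ (((n : ℝ) + 1) / 2))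
  refine ⟨N * C / e + f / (N * c), by positivity, fun t x y hS => ?_⟩
  obtain ⟨I, G, hP, ht, hG, ⟨h1, h2⟩, h3, h4⟩ := h t x y hS
  have hκ : 0 ≤ κ t x y := le_trans (by positivity) h3
  have hP0 : N * c * (t * G) ≤ P t x y := by
    rw [hP]
    calc N * c * (t * G) = N * (t * (c * G)) := by ring
      _ ≤ _ := by gcongr
  have hPpos : 0 ≤ P t x y := le_trans (by positivity) hP0
  constructor
  · rw [inv_mul_le_iff₀ (by positivity)]
    calc κ t x y ≤ f * (t * G) := h4
      _ = f / (N * c) * (N * c * (t * G)) := by field_simp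
      _ ≤ f / (N * c) * P t x y := by gcongr
      _ ≤ _ := by
        gcongr
        exact le_add_of_nonneg_left (by positivity)
  · calc P t x y = N * (t * I) := hP
      _ ≤ N * (t * (C * G)) := by gcongr
      _ = N * C / e * (e * (t * G)) := by field_simp
      _ ≤ N * C / e * κ t x y := by gcongr
      _ ≤ _ := by
        gcongr
        exact le_add_of_nonneg_right (by positivity)

/-! ### Comparability of `P` with each kernel on its region -/

lemma P_comparable_K1 {c : ℝ} (hc : 0 < c) : ∃ D : ℝ, 0 < D ∧ ∀ (t : ℝ) (x y : Rn n),
    (t, x, y) ∈ E1 n → D⁻¹ * K1 c t x y ≤ P t x y ∧ P t x y ≤ D * K1 c t x y := by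
  obtain ⟨b, B, hb, hB, h⟩ := integral_near (p := (n : ℝ) / 2) (by positivity)
  refine comparable_of_bounds hb hB (Real.exp_pos (-c)) one_pos fun t x y hS => ?_
  obtain ⟨ht, hx, hxy, h1, h2, h3⟩ := hS
  set R := ‖x‖
  set d := R - ‖par x y‖ with hd
  have hR : 0 < R := by linarith
  have h2' : d * (4 * R) < 1 := by rwa [lt_div_iff₀ (by positivity)] at h2
  have hpar : ‖par x y‖ = R - d := by ring
  have hI := h t d ‖perp x y‖ R ht hx h1 h2' (norm_nonneg _) h3
  rw [← hpar] at hI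
  refine ⟨_, (t ^ 2 + (d ^ 2 + ‖perp x y‖ ^ 2)) ^ (-((n : ℝ) / 2 + 1 / 2)), P_eq_Q t hxy, ht,
    by positivity, hI, ?_⟩
  have hA : 0 < t ^ 2 + (d ^ 2 + ‖perp x y‖ ^ 2) := by positivity
  have hK : K1 c t x y = Real.exp (-c * (t * (1 + R))) *
      (t * (t ^ 2 + (d ^ 2 + ‖perp x y‖ ^ 2)) ^ (-((n : ℝ) / 2 + 1 / 2))) := by
    rw [K1, norm_sub_sq_eq hxy, show ((n : ℝ) + 1) / 2 = (n : ℝ) / 2 + 1 / 2 by ring,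
      Real.rpow_neg hA.le]
    ring
  have hd0 : 0 < d := lt_of_le_of_lt (by positivity) h1
  have hd4 : d < 1 / 4 := by nlinarith
  -- Indeed $(tR)^2=(t^2R)R<dR<1/4$; this bounds the exponent $c\,t(1+R)$ of $K_1$ by $c$.
  have htR : t * R < 1 / 2 := by
    have : (t * R) ^ 2 < (1 / 2) ^ 2 := by nlinarith
    exact lt_of_pow_lt_pow_left₀ 2 (by norm_num) this
  have ht2 : t < 1 / 2 := by nlinarith
  rw [hK]
  constructor
  · gcongr
    nlinarith
  · gcongr
    rw [Real.exp_le_one_iff]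
    have : 0 < c * (t * (1 + R)) := by positivity
    linarith

lemma P_comparable_K2 {c : ℝ} (hc : 0 < c) : ∃ D : ℝ, 0 < D ∧ ∀ (t : ℝ) (x y : Rn n),
    (t, x, y) ∈ E2 n → D⁻¹ * K2 c t x y ≤ P t x y ∧ P t x y ≤ D * K2 c t x y := by
  obtain ⟨b, B, hb, hB, h⟩ := integral_mid (p := (n : ℝ) / 2) (by positivity)
  refine comparable_of_bounds (e := 3 ^ (-((n : ℝ) / 2 + 1)) * Real.exp (-(c * 2))) hb hB
    (by positivity) one_pos fun t x y hS => ?_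
  obtain ⟨ht, hx, hxy, htR, h1, h2, h3⟩ := hS
  set R := ‖x‖
  set w := ‖perp x y‖
  have hR : 0 < R := by linarith
  set σ := (R - ‖par x y‖) / R with hσ
  have hd : R - ‖par x y‖ = σ * R := by rw [hσ]; field_simp
  have hpar : ‖par x y‖ = (1 - σ) * R := by linarith
  rw [hd] at h1 h2
  have h1' : t ^ 2 < σ := lt_of_mul_lt_mul_right h1 hR.le
  have h2' : σ < 1 / 4 := lt_of_mul_lt_mul_right (by linarith) hR.le
  have h3' : w ^ 2 < σ := (Real.lt_sqrt (norm_nonneg _)).1 h3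
  have hσ0 : 0 < σ := lt_of_le_of_lt (by positivity) h1'
  have hI := h t σ w R ht hx htR h1' h2' h3'
  rw [← hpar] at hI
  refine ⟨_, R⁻¹ * σ ^ (-((n : ℝ) / 2 + 1)), P_eq_Q t hxy, ht,
    by positivity, hI, ?_⟩
  have hlt : ‖par x y‖ < R := by nlinarith
  have hK : K2 c t x y = (t ^ 2 + σ + w ^ 2) ^ (-((n : ℝ) / 2 + 1)) *
      Real.exp (-(c * ((t ^ 2 + w ^ 2) / σ))) * (t * R⁻¹) := by
    rw [K2, if_pos ⟨hx, hxy, by nlinarith, hlt⟩, norm_sub_par hxy hlt.le,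
      show ((n : ℝ) + 2) / 2 = (n : ℝ) / 2 + 1 by ring]
    change t / R * (t ^ 2 + σ + w ^ 2) ^ (-((n : ℝ) / 2 + 1)) *
      Real.exp (-c * ((t ^ 2 + w ^ 2) * R / (R - ‖par x y‖))) = _
    rw [hd, mul_div_mul_right _ _ hR.ne']
    ring_nf
  rw [hK]
  -- Both $t^2$ and $w^2$ are below $\sigma$, so the exponential is harmless and the base
  -- $t^2+\sigma+w^2$ lies between $\sigma$ and $3\sigma$.
  have hq : (t ^ 2 + w ^ 2) / σ ≤ 2 := by rw [div_le_iff₀ hσ0]; linarith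
  constructor
  · calc 3 ^ (-((n : ℝ) / 2 + 1)) * Real.exp (-(c * 2)) *
        (t * (R⁻¹ * σ ^ (-((n : ℝ) / 2 + 1))))
        = (3 * σ) ^ (-((n : ℝ) / 2 + 1)) * Real.exp (-(c * 2)) * (t * R⁻¹) := by
          rw [Real.mul_rpow (by norm_num) hσ0.le]; ring
      _ ≤ _ := by
          gcongr ?_ * ?_ * _
          · exact Real.rpow_le_rpow_of_nonpos (by positivity) (by linarith)
              (by linarith [show (0 : ℝ) ≤ n by positivity])
          · gcongr
  · calc _ ≤ σ ^ (-((n : ℝ) / 2 + 1)) * 1 * (t * R⁻¹) := by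
          gcongr ?_ * ?_ * _
          · exact Real.rpow_le_rpow_of_nonpos hσ0 (by nlinarith)
              (by linarith [show (0 : ℝ) ≤ n by positivity])
          · rw [Real.exp_le_one_iff, neg_nonpos]; positivity
      _ = _ := by ring

lemma P_comparable_K3 {c : ℝ} (hc : 0 < c) : ∃ D : ℝ, 0 < D ∧ ∀ (t : ℝ) (x y : Rn n),
    (t, x, y) ∈ E3 n → D⁻¹ * K3 c t x y ≤ P t x y ∧ P t x y ≤ D * K3 c t x y := by
  obtain ⟨b, B, hb, hB, h⟩ := integral_large_t (p := (n : ℝ) / 2) (by positivity)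
  refine comparable_of_bounds (e := Real.exp (-c)) hb hB
    (by positivity) one_pos fun t x y hS => ?_
  obtain ⟨ht1, hx, hy⟩ := hS
  have ht : 0 < t := by linarith
  refine ⟨_, t⁻¹, P_eq t x y, ht, by positivity, h t _ ht1.le (by fun_prop) ?_, ?_⟩
  · intro s hs
    refine ⟨by positivity, ?_⟩
    have h1 : ‖y - Real.exp (-s) • x‖ ≤ 2 := by
      refine (norm_sub_le _ _).trans ?_
      rw [norm_smul, Real.norm_of_nonneg (Real.exp_pos _).le]
      have : Real.exp (-s) ≤ 1 := by rw [Real.exp_le_one_iff]; linarith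
      nlinarith [norm_nonneg x]
    nlinarith [norm_nonneg (y - Real.exp (-s) • x)]
  · rw [mul_inv_cancel₀ ht.ne', K3, min_eq_left ht1.le, one_mul, mul_one, one_mul]
    have : ‖y‖ ^ 2 ≤ 1 := by nlinarith [norm_nonneg y]
    constructor
    · gcongr
      nlinarith
    · rw [Real.exp_le_one_iff]
      nlinarith [sq_nonneg ‖y‖]

lemma P_comparable_K4 {c c' : ℝ} (hc : 0 < c) (hc' : 0 < c') :
    ∃ D : ℝ, 0 < D ∧ ∀ (t : ℝ) (x y : Rn n),
    (t, x, y) ∈ E4 n → D⁻¹ * K4 c c' t x y ≤ P t x y ∧ P t x y ≤ D * K4 c c' t x y := by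
  obtain ⟨b, B, hb, hB, h⟩ := integral_far (p := (n : ℝ) / 2) (by positivity)
  refine comparable_of_bounds (e := Real.exp (-c) * Real.exp (-c')) hb hB
    (by positivity) one_pos fun t x y hS => ?_
  obtain ⟨hx, hxy, ht, h1, h2, h3⟩ := hS
  set R := ‖x‖
  set a := ‖par x y‖
  set w := ‖perp x y‖
  have hR : 0 < R := (Real.exp_pos _).trans hx
  have hL : 16 < Real.log R := (Real.lt_log_iff_exp_lt hR).2 hx
  have ha : 0 < a := lt_of_lt_of_le (by positivity) h1
  have hl1 : 2 / 3 * Real.log R ≤ Real.log a := by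
    rw [← Real.log_rpow hR]; exact Real.log_le_log (by positivity) h1
  have hl2 : Real.log a ≤ 3 / 4 * Real.log R := by
    rw [← Real.log_rpow hR]; exact Real.log_le_log ha h2
  have hla := Real.log_le_sub_one_of_pos ha
  set s₀ := Real.log (R / a) with hs₀
  have hs₀' : s₀ = Real.log R - Real.log a := Real.log_div hR.ne' ha.ne'
  have hRa : a * Real.exp s₀ = R := by
    rw [hs₀, Real.exp_log (by positivity)]; field_simp
  have ht0 : 0 < t := by
    have := Real.sqrt_pos.2 (show 0 < Real.log R by linarith)
    rw [ht]; positivity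
  have ht2 : t ^ 2 = Real.log R / 4 := by
    rw [ht, div_pow, Real.sq_sqrt (by linarith)]; norm_num
  have hw0 : 0 ≤ w := norm_nonneg _
  -- The powers $2/3$ and $3/4$ place $s_0$ between $\tfrac14\log R$ and $\tfrac13\log R$. Hence
  -- $s_0\ge4$ by $\log R>16$, $t^2=\tfrac14\log R\le s_0$, and $s_0\le\log a\le a$.
  have hI := h t a w s₀ ht0 (by linarith) (by linarith) (by linarith) (by linarith)
    (by nlinarith)
  rw [hRa] at hI
  have hs₀0 : 0 < s₀ := by linarith
  refine ⟨_, s₀ ^ (-(3 / 2 : ℝ)) * a⁻¹, P_eq_Q t hxy, ht0, by positivity, hI, ?_⟩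
  have haR : a < R / 2 := by nlinarith [Real.add_one_le_exp s₀]
  have hK : K4 c c' t x y = Real.exp (-(c * (t ^ 2 / s₀))) * Real.exp (-(c' * w ^ 2)) *
      (t * (s₀ ^ (-(3 / 2 : ℝ)) * a⁻¹)) := by
    rw [K4, if_pos ⟨hxy, by linarith, haR⟩, ← neg_mul, ← neg_mul]
    change t / a * s₀ ^ (-(3 / 2 : ℝ)) * _ * _ = _
    ring
  rw [hK]
  constructor
  · gcongr
    · have : t ^ 2 / s₀ ≤ 1 := by rw [div_le_one hs₀0]; linarith
      nlinarith
    · have : w ^ 2 ≤ 1 := by nlinarith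
      nlinarith
  · gcongr
    refine mul_le_one₀ ?_ (Real.exp_pos _).le ?_
    · rw [Real.exp_le_one_iff, neg_nonpos]; positivity
    · rw [Real.exp_le_one_iff, neg_nonpos]; positivity

/-! ### Points at which one kernel dominates the others -/

lemma K1_nonneg {c t : ℝ} (ht : 0 < t) (x y : Rn n) : 0 ≤ K1 c t x y := by
  unfold K1; positivity

lemma K2_nonneg {c t : ℝ} (ht : 0 < t) (x y : Rn n) : 0 ≤ K2 c t x y := by
  unfold K2; split_ifs
  · positivity
  · exact le_rfl

lemma K3_nonneg {c t : ℝ} (ht : 0 < t) (x y : Rn n) : 0 ≤ K3 c t x y := by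
  unfold K3; positivity

lemma K4_nonneg {c c' t : ℝ} (ht : 0 < t) (x y : Rn n) : 0 ≤ K4 c c' t x y := by
  unfold K4; split_ifs with h
  · have h0 : 0 < ‖par x y‖ := by linarith [h.2.1]
    have : 0 ≤ Real.log (‖x‖ / ‖par x y‖) :=
      Real.log_nonneg (by rw [le_div_iff₀ h0]; linarith [h.2.2])
    have := Real.rpow_nonneg this (-((3 : ℝ) / 2))
    positivity
  · exact le_rfl

lemma K_nonneg (c : Fin 5 → ℝ) {t : ℝ} (ht : 0 < t) (x y : Rn n) (i : Fin 4) :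
    0 ≤ K c i t x y := by
  fin_cases i
  · exact K1_nonneg ht x y
  · exact K2_nonneg ht x y
  · exact K3_nonneg ht x y
  · exact K4_nonneg ht x y

/-! ### The kernels at collinear points. -/

lemma exists_norm_eq_one (hn : 1 ≤ n) : ∃ e : Rn n, ‖e‖ = 1 :=
  ⟨EuclideanSpace.single ⟨0, hn⟩ 1, by simp⟩

lemma inner_smul_smul_self {e : Rn n} (he : ‖e‖ = 1)
    (R a : ℝ) : inner ℝ (R • e) (a • e) = R * a := by
  rw [inner_smul_left, inner_smul_right, real_inner_self_eq_norm_sq, he]; simp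

lemma norm_smul_unit {e : Rn n} (he : ‖e‖ = 1) {R : ℝ} (hR : 0 ≤ R) : ‖R • e‖ = R := by
  rw [norm_smul, he, mul_one, Real.norm_of_nonneg hR]

lemma par_smul_smul {e : Rn n} (he : ‖e‖ = 1)
    {R : ℝ} (hR : 0 < R) (a : ℝ) : par (R • e) (a • e) = a • e := by
  have hx : R • e ≠ 0 := by rw [← norm_pos_iff, norm_smul_unit he hR.le]; exact hR
  rw [par, if_neg hx, inner_smul_smul_self he, norm_smul_unit he hR.le, smul_smul]
  congr 1; field_simp

lemma perp_smul_smul {e : Rn n} (he : ‖e‖ = 1)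
    {R : ℝ} (hR : 0 < R) (a : ℝ) : perp (R • e) (a • e) = 0 := by
  rw [perp, par_smul_smul he hR, sub_self]

lemma norm_smul_sub_smul {e : Rn n} (he : ‖e‖ = 1)
    {R a : ℝ} (h : a ≤ R) : ‖R • e - a • e‖ = R - a := by
  rw [← sub_smul, norm_smul_unit he (by linarith)]

lemma K1_collinear {e : Rn n} (he : ‖e‖ = 1) {R a : ℝ} (c t : ℝ) (hR : 0 < R) (h : a ≤ R) :
    K1 c t (R • e) (a • e) =
      t / (t ^ 2 + (R - a) ^ 2) ^ (((n : ℝ) + 1) / 2) * Real.exp (-c * (t * (1 + R))) := by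
  rw [K1, norm_smul_sub_smul he h, norm_smul_unit he hR.le]

lemma K2_collinear {e : Rn n} (he : ‖e‖ = 1)
    {R a : ℝ} (c t : ℝ) (hR : 1 < R) (h : R / 2 ≤ a) (haR : a < R) :
    K2 c t (R • e) (a • e) = t / R * (t ^ 2 + (R - a) / R) ^ (-(((n : ℝ) + 2) / 2)) *
      Real.exp (-c * (t ^ 2 * R / (R - a))) := by
  have hR0 : 0 < R := by linarith
  have ha0 : 0 < a := by linarith
  rw [K2, par_smul_smul he hR0, perp_smul_smul he hR0, inner_smul_smul_self he,
    norm_smul_sub_smul he haR.le, norm_smul_unit he hR0.le, norm_smul_unit he ha0.le,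
    if_pos ⟨hR, by positivity, h, haR⟩]
  simp

lemma K2_collinear_eq_zero {e : Rn n} (he : ‖e‖ = 1)
    {R a : ℝ} (c t : ℝ) (hR : 0 < R) (ha : 0 < a) (h : a < R / 2) :
    K2 c t (R • e) (a • e) = 0 := by
  rw [K2, if_neg]
  rw [par_smul_smul he hR, norm_smul_unit he hR.le, norm_smul_unit he ha.le]
  exact fun h' => absurd h'.2.2.1 (not_le.2 h)

lemma K3_collinear {e : Rn n} (he : ‖e‖ = 1) {a : ℝ} (c t : ℝ) (x : Rn n) (ha : 0 < a) :
    K3 c t x (a • e) = min 1 t * Real.exp (-c * a ^ 2) := by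
  rw [K3, norm_smul_unit he ha.le]

lemma K4_collinear {e : Rn n} (he : ‖e‖ = 1) {R a : ℝ} (c c' t : ℝ) (ha : 1 < a) (h : a < R / 2) :
    K4 c c' t (R • e) (a • e) = t / a * Real.log (R / a) ^ (-((3 : ℝ) / 2)) *
      Real.exp (-c * (t ^ 2 / Real.log (R / a))) := by
  have hR0 : 0 < R := by linarith
  have ha0 : 0 < a := by linarith
  rw [K4, par_smul_smul he hR0, perp_smul_smul he hR0, inner_smul_smul_self he,
    norm_smul_unit he hR0.le, norm_smul_unit he ha0.le, if_pos ⟨by positivity, ha, h⟩]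
  simp

lemma K4_collinear_eq_zero {e : Rn n} (he : ‖e‖ = 1)
    {R a : ℝ} (c c' t : ℝ) (hR : 0 < R) (ha : 0 < a) (h : R / 2 ≤ a) :
    K4 c c' t (R • e) (a • e) = 0 := by
  rw [K4, if_neg]
  rw [par_smul_smul he hR, norm_smul_unit he hR.le, norm_smul_unit he ha.le]
  exact fun h' => absurd h'.2.2 (not_lt.2 h)

/-- Take $|x|=2$ and $t=|x-y|=\delta\to0$. Then $K_1\sim\delta^{-n}$, $K_2\lesssim\delta^{-n/2}$,
$K_3\le\delta$ and $K_4=0$, so the gain is $\delta^{n/2}$, which needs $n\ge1$. -/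
lemma K1_dominates (hn : 1 ≤ n) {c₁ c₂ c₃ : ℝ} (c₄ c₅ : ℝ) (h1 : 0 < c₁) (h2 : 0 < c₂)
    (h3 : 0 < c₃) {ε : ℝ} (hε : 0 < ε) : ∃ (t : ℝ) (x y : Rn n), (t, x, y) ∈ E1 n ∧
      K2 c₂ t x y < ε * K1 c₁ t x y ∧ K3 c₃ t x y < ε * K1 c₁ t x y ∧
      K4 c₄ c₅ t x y < ε * K1 c₁ t x y := by
  obtain ⟨e, he⟩ := exists_norm_eq_one hn
  have hn' : (1 : ℝ) ≤ n := by exact_mod_cast hn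
  set M : ℝ := ε * (2 ^ (-(((n : ℝ) + 1) / 2)) * Real.exp (-c₁ * 3)) with hM
  have hM0 : 0 < M := by positivity
  have hlim : Filter.Tendsto (fun δ : ℝ => 2 ^ (((n : ℝ) + 2) / 2) * δ ^ ((n : ℝ) / 2))
      (nhdsWithin 0 (Ioi 0)) (nhds 0) := by
    have : ContinuousAt (fun δ : ℝ => 2 ^ (((n : ℝ) + 2) / 2) * δ ^ ((n : ℝ) / 2)) 0 :=
      (Real.continuousAt_rpow_const 0 ((n : ℝ) / 2) (Or.inr (by positivity))).const_mul _
    have h := this.tendsto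
    rw [Real.zero_rpow (by positivity), mul_zero] at h
    exact h.mono_left nhdsWithin_le_nhds
  obtain ⟨δ, hδM, hδ, hδ8⟩ := ((hlim.eventually_lt_const hM0).and
    (Filter.eventually_mem_set.2 (Ioo_mem_nhdsGT (show (0 : ℝ) < 1 / 8 by norm_num)))).exists
  have ha : (0 : ℝ) < 2 - δ := by linarith
  have key : δ * (δ / 2) ^ (-(((n : ℝ) + 2) / 2)) < ε * K1 c₁ δ ((2 : ℝ) • e) ((2 - δ) • e) := by
    rw [K1_collinear he c₁ δ two_pos (by linarith), sub_sub_cancel]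
    have e1 : (δ ^ 2 + δ ^ 2) ^ (((n : ℝ) + 1) / 2)
        = 2 ^ (((n : ℝ) + 1) / 2) * δ ^ ((n : ℝ) + 1) := by
      rw [← two_mul, Real.mul_rpow two_pos.le (by positivity), ← Real.rpow_natCast δ 2,
        ← Real.rpow_mul hδ.le]
      congr 2; push_cast; ring
    have e2 : (δ / 2) ^ (-(((n : ℝ) + 2) / 2))
        = 2 ^ (((n : ℝ) + 2) / 2) * δ ^ ((n : ℝ) / 2) * δ ^ (-((n : ℝ) + 1)) := by
      rw [Real.div_rpow hδ.le two_pos.le, mul_assoc, ← Real.rpow_add hδ,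
        Real.rpow_neg two_pos.le, div_inv_eq_mul, mul_comm]
      congr 2; ring
    have e3 : Real.exp (-c₁ * 3) ≤ Real.exp (-c₁ * (δ * (1 + 2))) := by
      rw [Real.exp_le_exp]; nlinarith
    rw [e1, e2]
    calc δ * (2 ^ (((n : ℝ) + 2) / 2) * δ ^ ((n : ℝ) / 2) * δ ^ (-((n : ℝ) + 1)))
        < δ * (M * δ ^ (-((n : ℝ) + 1))) := by gcongr
      _ = ε * (δ / (2 ^ (((n : ℝ) + 1) / 2) * δ ^ ((n : ℝ) + 1)) * Real.exp (-c₁ * 3)) := by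
        rw [hM, Real.rpow_neg two_pos.le, Real.rpow_neg hδ.le]; field_simp
      _ ≤ _ := by gcongr
  refine ⟨δ, (2 : ℝ) • e, (2 - δ) • e, ?_, ?_, ?_, ?_⟩
  · simp only [E1, mem_ofPred_eq, inner_smul_smul_self he, par_smul_smul he two_pos,
      perp_smul_smul he two_pos, norm_smul_unit he two_pos.le, norm_smul_unit he ha.le, norm_zero]
    refine ⟨hδ, by norm_num, by positivity, by nlinarith, by linarith, by linarith⟩
  · refine lt_of_le_of_lt ?_ key
    rw [K2_collinear he c₂ δ (by norm_num) (by linarith) (by linarith), sub_sub_cancel]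
    calc _ ≤ δ / 2 * (δ / 2) ^ (-(((n : ℝ) + 2) / 2)) * 1 := by
          gcongr ?_ * ?_ * ?_
          · exact Real.rpow_le_rpow_of_nonpos (by positivity) (by nlinarith)
              (by linarith)
          · rw [Real.exp_le_one_iff, neg_mul, neg_nonpos]; positivity
      _ ≤ _ := by
          rw [mul_one]
          gcongr
          linarith
  · refine lt_of_le_of_lt ?_ key
    rw [K3_collinear he c₃ δ _ ha, min_eq_right (by linarith)]
    gcongr
    refine le_trans (b := 1) ?_ ?_
    · rw [Real.exp_le_one_iff, neg_mul, neg_nonpos]; positivity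
    · exact Real.one_le_rpow_of_pos_of_le_one_of_nonpos (by positivity) (by linarith)
        (by linarith)
  · refine lt_of_le_of_lt ?_ key
    rw [K4_collinear_eq_zero he c₄ c₅ δ two_pos ha (by linarith)]
    positivity

/-- Fix $t=1/4$ and $a=\tfrac78R$, and let $R\to\infty$. Then $K_2=\kappa/R$ exactly, $K_1$ and
$K_3$ decay exponentially, and $K_4=0$. -/
lemma K2_dominates (hn : 1 ≤ n) {c₁ c₂ c₃ : ℝ} (c₄ c₅ : ℝ) (h1 : 0 < c₁)
    (h3 : 0 < c₃) {ε : ℝ} (hε : 0 < ε) : ∃ (t : ℝ) (x y : Rn n), (t, x, y) ∈ E2 n ∧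
      K1 c₁ t x y < ε * K2 c₂ t x y ∧ K3 c₃ t x y < ε * K2 c₂ t x y ∧
      K4 c₄ c₅ t x y < ε * K2 c₂ t x y := by
  obtain ⟨e, he⟩ := exists_norm_eq_one hn
  obtain ⟨C₁, hC₁, hexp₁⟩ := exp_neg_le_rpow' (k := 2) (c := c₁ / 4) two_pos (by positivity)
  obtain ⟨C₃, hC₃, hexp₃⟩ := exp_neg_le_rpow' (k := 2) (c := c₃ * (49 / 64)) two_pos
    (by positivity)
  set κ : ℝ := (1 / 4) * (1 / 16 + 1 / 8) ^ (-(((n : ℝ) + 2) / 2)) * Real.exp (-c₂ * (1 / 2))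
    with hκ
  have hκ0 : 0 < κ := by positivity
  set b : ℝ := (1 / 4) / (1 / 16 : ℝ) ^ (((n : ℝ) + 1) / 2) with hb
  have hb0 : 0 < b := by positivity
  -- Large enough that $(bC_1+C_3)R^{-2}<\varepsilon\kappa R^{-1}$; the summand 5 ensures $tR>1$.
  set R : ℝ := 5 + (b * C₁ + C₃) / (ε * κ) with hR
  have hR5 : 5 ≤ R := le_add_of_nonneg_right (by positivity)
  have hR0 : 0 < R := by linarith
  have ha : 0 < 7 / 8 * R := by positivity
  have hbig : b * C₁ + C₃ < ε * κ * R := by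
    rw [hR, mul_add, mul_div_cancel₀ _ (by positivity)]
    linarith [mul_pos hε hκ0]
  have hK2 : K2 c₂ (1 / 4) (R • e) ((7 / 8 * R) • e) = κ * R⁻¹ := by
    rw [K2_collinear he c₂ _ (by linarith) (by linarith) (by linarith), hκ]
    have e1 : (R - 7 / 8 * R) / R = 1 / 8 := by field_simp; norm_num
    have e2 : (1 / 4 : ℝ) ^ 2 * R / (R - 7 / 8 * R) = 1 / 2 := by
      rw [show R - 7 / 8 * R = 1 / 8 * R by ring]; field_simp; norm_num
    rw [e1, e2]; norm_num; ring
  have hsq : R ^ (-2 : ℝ) = R⁻¹ * R⁻¹ := by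
    rw [Real.rpow_neg hR0.le, Real.rpow_two, sq, mul_inv]
  have key : (b * C₁ + C₃) * R ^ (-2 : ℝ) < ε * K2 c₂ (1 / 4) (R • e) ((7 / 8 * R) • e) := by
    rw [hK2, hsq]
    calc (b * C₁ + C₃) * (R⁻¹ * R⁻¹) < ε * κ * R * (R⁻¹ * R⁻¹) := by gcongr
      _ = _ := by field_simp
  have hrp : 0 < R ^ (-2 : ℝ) := by positivity
  refine ⟨1 / 4, R • e, (7 / 8 * R) • e, ?_, ?_, ?_, ?_⟩
  · simp only [E2, mem_ofPred_eq, inner_smul_smul_self he, par_smul_smul he hR0,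
      perp_smul_smul he hR0, norm_smul_unit he hR0.le, norm_smul_unit he ha.le, norm_zero]
    refine ⟨by norm_num, by linarith, by positivity, by linarith, by linarith, by linarith, ?_⟩
    rw [Real.sqrt_pos]
    exact div_pos (by linarith) hR0
  · refine lt_of_le_of_lt ?_ key
    rw [K1_collinear he c₁ _ hR0 (by linarith)]
    calc _ ≤ b * (C₁ * R ^ (-2 : ℝ)) := by
          gcongr ?_ * ?_
          · rw [hb]
            gcongr
            nlinarith [sq_nonneg (R - 7 / 8 * R)]
          · refine le_trans ?_ (hexp₁ R hR0)
            rw [Real.exp_le_exp]; nlinarith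
      _ ≤ _ := by nlinarith [mul_pos hC₃ hrp]
  · refine lt_of_le_of_lt ?_ key
    rw [K3_collinear he c₃ _ _ ha, min_eq_right (by norm_num)]
    calc _ ≤ 1 * (C₃ * R ^ (-2 : ℝ)) := by
          gcongr ?_ * ?_
          · norm_num
          · refine le_trans ?_ (hexp₃ R hR0)
            rw [Real.exp_le_exp]
            have : R ≤ R ^ 2 := by nlinarith
            nlinarith [mul_le_mul_of_nonneg_left this h3.le]
      _ ≤ _ := by nlinarith [mul_pos (mul_pos hb0 hC₁) hrp]
  · refine lt_of_le_of_lt ?_ key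
    rw [K4_collinear_eq_zero he c₄ c₅ _ hR0 ha (by linarith)]
    positivity

/-- At $x=y=0$ one has $K_3=1$ for $t\ge1$, the cutoffs kill $K_2$ and $K_4$, and $K_1$ decays
exponentially as $t\to\infty$. -/
lemma K3_dominates {c₁ c₃ : ℝ} (c₂ c₄ c₅ : ℝ) (h1 : 0 < c₁) {ε : ℝ} (hε : 0 < ε) :
    ∃ (t : ℝ) (x y : Rn n), (t, x, y) ∈ E3 n ∧
      K1 c₁ t x y < ε * K3 c₃ t x y ∧ K2 c₂ t x y < ε * K3 c₃ t x y ∧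
      K4 c₄ c₅ t x y < ε * K3 c₃ t x y := by
  obtain ⟨C, hC, hexp⟩ := exp_neg_le_rpow' (k := 2) two_pos h1
  set t : ℝ := 2 + C / ε with ht
  have ht2 : 2 ≤ t := le_add_of_nonneg_right (by positivity)
  have ht0 : 0 < t := by linarith
  have hK3 : K3 c₃ t (0 : Rn n) 0 = 1 := by
    rw [K3, min_eq_left (by linarith)]; simp
  have hbig : C < ε * t := by
    rw [ht, mul_add, mul_div_cancel₀ _ hε.ne']; linarith
  refine ⟨t, 0, 0, ?_, ?_, ?_, ?_⟩
  · simp only [E3, mem_ofPred_eq, norm_zero]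
    exact ⟨by linarith, by norm_num, by norm_num⟩
  · rw [hK3, mul_one, K1]
    simp only [sub_self, norm_zero, add_zero, mul_one, ne_eq, OfNat.ofNat_ne_zero,
      not_false_eq_true, zero_pow]
    have hden : 1 ≤ (t ^ 2) ^ (((n : ℝ) + 1) / 2) :=
      Real.one_le_rpow (by nlinarith) (by positivity)
    calc t / (t ^ 2) ^ (((n : ℝ) + 1) / 2) * Real.exp (-c₁ * t) ≤ t * (C * t ^ (-2 : ℝ)) := by
          gcongr ?_ * ?_
          · exact div_le_self ht0.le hden
          · rw [neg_mul]; exact hexp t ht0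
      _ = C / t := by
          rw [Real.rpow_neg ht0.le, Real.rpow_two]; field_simp
      _ < ε := by rwa [div_lt_iff₀ ht0]
  · rw [hK3, mul_one, K2, if_neg (by simp)]; exact hε
  · rw [hK3, mul_one, K4, if_neg (by simp)]; exact hε

/-- Take $R=e^{4m^2}$, $a=R^{3/4}=e^{3m^2}$ and $t=m$, so that $\log(R/a)=m^2=t^2$. Then
$K_4=e^{-c_4}m^{-2}a^{-1}$, while $K_1$ and $K_3$ are exponentially small in $a$ and $K_2=0$. -/
lemma K4_dominates (hn : 1 ≤ n) {c₁ c₃ c₄ : ℝ} (c₂ c₅ : ℝ) (h1 : 0 < c₁)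
    (h3 : 0 < c₃) {ε : ℝ} (hε : 0 < ε) : ∃ (t : ℝ) (x y : Rn n), (t, x, y) ∈ E4 n ∧
      K1 c₁ t x y < ε * K4 c₄ c₅ t x y ∧ K2 c₂ t x y < ε * K4 c₄ c₅ t x y ∧
      K3 c₃ t x y < ε * K4 c₄ c₅ t x y := by
  obtain ⟨e, he⟩ := exists_norm_eq_one hn
  obtain ⟨C₁, hC₁, hexp₁⟩ := exp_neg_le_rpow' (k := 4) four_pos h1
  obtain ⟨C₃, hC₃, hexp₃⟩ := exp_neg_le_rpow' (k := 4) four_pos h3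
  set κ : ℝ := Real.exp (-c₄) with hκ
  have hκ0 : 0 < κ := Real.exp_pos _
  set m : ℝ := 3 + (C₁ + C₃) / (ε * κ) with hm
  have hm3 : 3 ≤ m := le_add_of_nonneg_right (by positivity)
  have hm0 : 0 < m := by linarith
  have hbig : C₁ + C₃ < ε * κ * m := by
    rw [hm, mul_add, mul_div_cancel₀ _ (by positivity)]
    linarith [mul_pos hε hκ0]
  set a : ℝ := Real.exp (3 * m ^ 2) with ha
  set R : ℝ := Real.exp (4 * m ^ 2) with hR
  have ha0 : 0 < a := Real.exp_pos _
  have hR0 : 0 < R := Real.exp_pos _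
  have hRa : R / a = Real.exp (m ^ 2) := by
    rw [hR, ha, ← Real.exp_sub]; congr 1; ring
  have hlog : Real.log (R / a) = m ^ 2 := by rw [hRa, Real.log_exp]
  have hma : m ^ 2 ≤ a := by
    have := Real.add_one_le_exp (3 * m ^ 2); rw [ha]; nlinarith
  have ha1 : 1 < a := by nlinarith
  have haR : a < R / 2 := by
    have h5 := Real.add_one_le_exp (m ^ 2)
    have : R = a * Real.exp (m ^ 2) := by rw [← hRa]; field_simp
    rw [this]
    nlinarith [mul_le_mul_of_nonneg_left h5 ha0.le, mul_le_mul hm3 hm3 (by norm_num) hm0.le]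
  have hK4 : K4 c₄ c₅ m (R • e) (a • e) = κ * ((m ^ 2)⁻¹ * a⁻¹) := by
    rw [K4_collinear he c₄ c₅ m ha1 haR, hlog, div_self (by positivity), mul_one, ← hκ]
    have : (m ^ 2) ^ (-((3 : ℝ) / 2)) = (m ^ 3)⁻¹ := by
      rw [Real.rpow_neg (by positivity), ← Real.rpow_natCast m 2, ← Real.rpow_mul hm0.le,
        ← Real.rpow_natCast m 3]
      norm_num
    rw [this]; field_simp
  have key : (C₁ + C₃) * (a * a ^ (-4 : ℝ)) < ε * K4 c₄ c₅ m (R • e) (a • e) := by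
    rw [hK4]
    have e1 : a * a ^ (-4 : ℝ) = a⁻¹ * a⁻¹ * a⁻¹ := by
      rw [Real.rpow_neg ha0.le, show (4 : ℝ) = ((4 : ℕ) : ℝ) by norm_num, Real.rpow_natCast]
      field_simp
    -- The spare factor $m$ supplies the smallness relative to $\varepsilon$; it costs nothing
    -- because $a$ dominates powers of $m$.
    have e2 : m * (a⁻¹ * a⁻¹) ≤ (m ^ 2)⁻¹ := by
      have i1 : m * m ^ 2 ≤ a * a := by
        have : m ≤ a := by nlinarith
        gcongr
      rw [← mul_inv, ← div_eq_mul_inv, div_le_iff₀ (by positivity), ← div_eq_inv_mul,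
        le_div_iff₀ (by positivity)]
      exact i1
    rw [e1]
    calc (C₁ + C₃) * (a⁻¹ * a⁻¹ * a⁻¹) < ε * κ * m * (a⁻¹ * a⁻¹ * a⁻¹) := by gcongr
      _ = ε * (κ * ((m * (a⁻¹ * a⁻¹)) * a⁻¹)) := by ring
      _ ≤ _ := by gcongr
  have hrp : 0 < a * a ^ (-4 : ℝ) := by positivity
  refine ⟨m, R • e, a • e, ?_, ?_, ?_, ?_⟩
  · simp only [E4, mem_ofPred_eq, inner_smul_smul_self he, par_smul_smul he hR0,
      perp_smul_smul he hR0, norm_smul_unit he hR0.le, norm_smul_unit he ha0.le, norm_zero]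
    refine ⟨?_, by positivity, ?_, ?_, ?_, by norm_num⟩
    · rw [hR, Real.exp_lt_exp]; nlinarith
    · rw [hR, Real.log_exp, show 4 * m ^ 2 = (2 * m) ^ 2 by ring, Real.sqrt_sq (by positivity)]
      ring
    · rw [hR, ha, ← Real.exp_mul, Real.exp_le_exp]; nlinarith
    · rw [hR, ha, ← Real.exp_mul, Real.exp_le_exp]; linarith
  · refine lt_of_le_of_lt ?_ key
    rw [K1_collinear he c₁ _ hR0 (by linarith)]
    have hden : 1 ≤ (m ^ 2 + (R - a) ^ 2) ^ (((n : ℝ) + 1) / 2) :=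
      Real.one_le_rpow (by nlinarith [sq_nonneg (R - a)]) (by positivity)
    calc _ ≤ a * (C₁ * a ^ (-4 : ℝ)) := by
          gcongr ?_ * ?_
          · exact (div_le_self hm0.le hden).trans ((le_self_pow₀ (by linarith) two_ne_zero).trans hma)
          · refine le_trans ?_ (hexp₁ a ha0)
            rw [Real.exp_le_exp, neg_mul, neg_le_neg_iff]
            refine mul_le_mul_of_nonneg_left ?_ h1.le
            have : 1 * R ≤ m * R := mul_le_mul_of_nonneg_right (by linarith) hR0.le
            linarith
      _ ≤ _ := by linarith [mul_pos hC₃ hrp]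
  · refine lt_of_le_of_lt ?_ key
    rw [K2_collinear_eq_zero he c₂ _ hR0 ha0 haR]
    positivity
  · refine lt_of_le_of_lt ?_ key
    rw [K3_collinear he c₃ _ _ ha0, min_eq_left (by linarith)]
    calc _ ≤ a * (C₃ * a ^ (-4 : ℝ)) := by
          gcongr ?_ * ?_
          refine le_trans ?_ (hexp₃ a ha0)
          rw [Real.exp_le_exp, neg_mul, neg_le_neg_iff]
          refine mul_le_mul_of_nonneg_left ?_ h3.le
          exact le_self_pow₀ ha1.le two_ne_zero
      _ ≤ _ := by linarith [mul_pos hC₁ hrp]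

/-! ### Assembly over the four kernels. -/

lemma pos_of_mem_E {t : ℝ} {x y : Rn n} {i : Fin 4} (h : (t, x, y) ∈ E n i) : 0 < t := by
  fin_cases i
  · exact h.1
  · exact h.1
  · exact one_pos.trans h.1
  · obtain ⟨hx, -, ht, -⟩ := h
    rw [ht]
    have : 0 < Real.log ‖x‖ :=
      lt_trans (by norm_num) ((Real.lt_log_iff_exp_lt ((Real.exp_pos _).trans hx)).2 hx)
    have := Real.sqrt_pos.2 this
    positivity

lemma P_comparable (c : Fin 5 → ℝ) (hc : ∀ k, 0 < c k) (i : Fin 4) :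
    ∃ C : ℝ, 0 < C ∧ ∀ (t : ℝ) (x y : Rn n), (t, x, y) ∈ E n i →
      C⁻¹ * K c i t x y ≤ P t x y ∧ P t x y ≤ C * K c i t x y := by
  fin_cases i
  · exact P_comparable_K1 (hc 0)
  · exact P_comparable_K2 (hc 1)
  · exact P_comparable_K3 (hc 2)
  · exact P_comparable_K4 (hc 3) (hc 4)

lemma K_dominates (hn : 1 ≤ n) (c : Fin 5 → ℝ) (hc : ∀ k, 0 < c k) (i : Fin 4) {ε : ℝ}
    (hε : 0 < ε) : ∃ (t : ℝ) (x y : Rn n), (t, x, y) ∈ E n i ∧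
      ∀ j : Fin 4, j ≠ i → K c j t x y < ε * K c i t x y := by
  fin_cases i
  · obtain ⟨t, x, y, hE, h1, h2, h3⟩ := K1_dominates hn (c 3) (c 4) (hc 0) (hc 1) (hc 2) hε
    refine ⟨t, x, y, hE, fun j hj => ?_⟩
    fin_cases j
    exacts [absurd rfl hj, h1, h2, h3]
  · obtain ⟨t, x, y, hE, h1, h2, h3⟩ :=
      K2_dominates (c₂ := c 1) hn (c 3) (c 4) (hc 0) (hc 2) hε
    refine ⟨t, x, y, hE, fun j hj => ?_⟩
    fin_cases j
    exacts [h1, absurd rfl hj, h2, h3]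
  · obtain ⟨t, x, y, hE, h1, h2, h3⟩ :=
      K3_dominates (n := n) (c₃ := c 2) (c 1) (c 3) (c 4) (hc 0) hε
    refine ⟨t, x, y, hE, fun j hj => ?_⟩
    fin_cases j
    exacts [h1, h2, absurd rfl hj, h3]
  · obtain ⟨t, x, y, hE, h1, h2, h3⟩ :=
      K4_dominates (c₄ := c 3) hn (c 1) (c 4) (hc 0) (hc 2) hε
    refine ⟨t, x, y, hE, fun j hj => ?_⟩
    fin_cases j
    exacts [h1, h2, h3, absurd rfl hj]

lemma exists_K_lt_P (hn : 1 ≤ n) (c : Fin 5 → ℝ) (hc : ∀ k, 0 < c k) (i : Fin 4) {ε : ℝ}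
    (hε : 0 < ε) : ∃ (t : ℝ) (x y : Rn n), (t, x, y) ∈ E n i ∧
      ∀ j : Fin 4, j ≠ i → K c j t x y < ε * P t x y := by
  obtain ⟨C, hC, h⟩ := P_comparable (n := n) c hc i
  obtain ⟨t, x, y, hE, hK⟩ := K_dominates hn c hc i (ε := ε * C⁻¹) (by positivity)
  refine ⟨t, x, y, hE, fun j hj => (hK j hj).trans_le ?_⟩
  rw [mul_assoc]
  exact mul_le_mul_of_nonneg_left (h t x y hE).1 hε.le

lemma not_P_le_sum_erase (hn : 1 ≤ n) (c : Fin 5 → ℝ) (hc : ∀ k, 0 < c k) (i : Fin 4) (C : ℝ) :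
    ∃ (t : ℝ) (x y : Rn n), 0 < t ∧ C * ∑ j ∈ Finset.univ.erase i, K c j t x y < P t x y := by
  -- The 3 counts the remaining kernels, so their sum is at most $P_t/(|C|+1)$; the absolute value
  -- allows $C$ of any sign.
  obtain ⟨t, x, y, hE, h⟩ := exists_K_lt_P hn c hc i (ε := 1 / (3 * (|C| + 1))) (by positivity)
  have ht := pos_of_mem_E hE
  refine ⟨t, x, y, ht, ?_⟩
  have hS0 : 0 ≤ ∑ j ∈ Finset.univ.erase i, K c j t x y :=
    Finset.sum_nonneg fun j _ => K_nonneg c ht x y j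
  have hS : ∑ j ∈ Finset.univ.erase i, K c j t x y ≤ P t x y / (|C| + 1) := by
    have h1 := Finset.sum_le_card_nsmul (Finset.univ.erase i) (fun j => K c j t x y)
      (1 / (3 * (|C| + 1)) * P t x y) fun j hj => (h j (Finset.ne_of_mem_erase hj)).le
    rw [Finset.card_erase_of_mem (Finset.mem_univ i), Finset.card_univ, Fintype.card_fin,
      nsmul_eq_mul] at h1
    refine h1.trans (le_of_eq ?_)
    push_cast
    field_simp
  -- Positivity of $P_t$ is read off from $0\le K_j<\varepsilon P_t$ for any $j\ne i$.
  have hP : 0 < P t x y := by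
    obtain ⟨j, hj⟩ := exists_ne i
    have := (K_nonneg c ht x y j).trans_lt (h j hj)
    exact (pos_iff_pos_of_mul_pos this).1 (by positivity)
  calc C * ∑ j ∈ Finset.univ.erase i, K c j t x y
      ≤ |C| * (P t x y / (|C| + 1)) :=
        mul_le_mul (le_abs_self C) hS hS0 (abs_nonneg C)
    _ < P t x y := by
        rw [mul_div_assoc', div_lt_iff₀ (by positivity)]
        linarith

end OUPoisson

theorem theorem6p1 (n : ℕ) (hn : 1 ≤ n) (c : Fin 5 → ℝ) (hc : ∀ k, 0 < c k) :
    -- (a) `P_t ≃ K_i`, uniformly in `E_i`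
    (∀ i : Fin 4, ∃ C : ℝ, 0 < C ∧ ∀ (t : ℝ) (x y : OUPoisson.Rn n),
      (t, x, y) ∈ OUPoisson.E n i →
        C⁻¹ * OUPoisson.K c i t x y ≤ OUPoisson.P t x y ∧
        OUPoisson.P t x y ≤ C * OUPoisson.K c i t x y) ∧
    -- (b) there are points of `E_i` where every other kernel is arbitrarily small relative to `P_t`
    (∀ i : Fin 4, ∀ ε : ℝ, 0 < ε → ∃ (t : ℝ) (x y : OUPoisson.Rn n),
      (t, x, y) ∈ OUPoisson.E n i ∧
        ∀ j : Fin 4, j ≠ i → OUPoisson.K c j t x y < ε * OUPoisson.P t x y) ∧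
    -- (b) the upper bound of `P_t` by the sum of the four kernels fails without the `i`-th one
    (∀ i : Fin 4, ¬ ∃ C : ℝ, ∀ (t : ℝ) (x y : OUPoisson.Rn n), 0 < t →
      OUPoisson.P t x y ≤ C * ∑ j ∈ Finset.univ.erase i, OUPoisson.K c j t x y) := by
  refine ⟨OUPoisson.P_comparable c hc, fun i ε hε => OUPoisson.exists_K_lt_P hn c hc i hε, ?_⟩
  rintro i ⟨C, hC⟩
  obtain ⟨t, x, y, ht, h⟩ := OUPoisson.not_P_le_sum_erase hn c hc i C
  exact absurd (hC t x y ht) (not_le.2 h)
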